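/- Let $\mathcal A=C^\infty(\mathbb S^2)$ (complex valued smooth functions) on the unit sphere with spherical coordinates $\vartheta\in[0,\pi]$, $\phi\in[0,2\pi]$, and let $\mu$ be the rotation-invariant probability measure. Let $$D=\begin{pmatrix}\tfrac12+\partial_H&\partial_F\\ \partial_E&\tfrac12-\partial_H\end{pmatrix}\quad\text{on } L^2(\mathbb S^2,\mu)\otimes\mathbb C^2,$$ $$\partial_H=-i\,\tfrac{\partial}{\partial\phi},\qquad \partial_E=e^{i\phi}\Big(\tfrac{\partial}{\partial\vartheta}+i\cot\vartheta\,\tfrac{\partial}{\partial\phi}\Big),\qquad \partial_F=-e^{-i\phi}\Big(\tfrac{\partial}{\partial\vartheta}-i\cot\vartheta\,\tfrac{\partial}{\partial\phi}\Big).$$ Fix $\ell\in\frac12\mathbb N$ (with $0\in\mathbb N$). Let $V_\ell\simeq\mathbb C^{2\ell+1}$ have orthonormal basis $|\ell,m\rangle$, $m=-\ell,-\ell+1,\dots,\ell$, with $\rho_\ell(H)|\ell,m\rangle=m|\ell,m\rangle$, $\rho_\ell(E)|\ell,m\rangle=\sqrt{(\ell-m)(\ell+m+1)}\,|\ell,m+1\rangle$,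 $\rho_\ell(F)=\rho_\ell(E)^*$. The fuzzy sphere is the spectral triple $(\mathcal A_\ell,V_\ell\otimes\mathbb C^2,D_\ell)$ with $$\mathcal A_\ell=\mathrm{End}(V_\ell),\qquad D_\ell=\begin{pmatrix}\tfrac12+\rho_\ell(H)&\rho_\ell(F)\\ \rho_\ell(E)&\tfrac12-\rho_\ell(H)\end{pmatrix}.$$ For $x\in\mathbb S^2$ with coordinates $(\vartheta,\phi)$ let $$Q_{x;\ell}=\sum_{m,n=-\ell}^{\ell}\binom{2\ell}{\ell+m}^{\frac12}\binom{2\ell}{\ell+n}^{\frac12}e^{i(n-m)\phi}\,(\sin\tfrac\vartheta2)^{2\ell+m+n}(\cos\tfrac\vartheta2)^{2\ell-m-n}\,|\ell,m\rangle\langle\ell,n| ,$$ and define $\sigma_\ell(a)(x)=\mathrm{Tr}(Q_{x;\ell}\,a)$ for $a\in\mathcal A_\ell$, $\pi_\ell(f)=(2\ell+1)\int_{\mathbb S^2}f(x)\,Q_{x;\ell}\,d\mu(x)\in\mathcal A_\ell$ for $f\in\mathcal A$, and $B_\ell=\sigma_\ell\circ\pi_\ell$. A state $\varphi$ of $\mathcal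 A_\ell$ (a positive linear functional with $\varphi(1)=1$) is pulled back to $\varphi^\sharp=\varphi\circ\pi_\ell$ on $\mathcal A$, and $\delta_x(f)=f(x)$ for $x\in\mathbb S^2$. With operator norms on the Hilbert spaces above, and functions and matrices acting diagonally on the factor $\mathbb C^2$, define, with values in $[0,\infty]$, $$d_{\mathcal A,D}(\varphi,\psi)=\sup\{\varphi(f)-\psi(f): f=f^*\in\mathcal A,\ \|[D,f]\|\le1\},\qquad d^\flat_{\mathcal A,D}(\varphi,\psi)=d_{\mathcal A,D}(\varphi^\sharp,\psi^\sharp),$$ $$d_{\mathcal A_\ell,D_\ell}(\varphi,\psi)=\sup\{\varphi(a)-\psi(a): a=a^*\in\mathcal A_\ell,\ \|[D_\ell,a]\|\le1\},$$ $$d^{(\ell)}_{\mathcal A,D}(\varphi,\psi)=\sup\{\varphi(f)-\psi(f): f=f^*\in\mathcal A,\ \|[D,B_\ell(f)]\|\le1\}.$$ Then: 1. for all states $\varphi,\psi$ of $\mathcal A_\ell$, $\quad d^\flat_{\mathcal A,D}(\varphi,\psi)\le d_{\mathcal A_\ell,D_\ell}(\varphi,\psi)\le d^{(\ell)}_{\mathcal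 A,D}(\varphi^\sharp,\psi^\sharp)$; 2. $d^{(\ell)}_{\mathcal A,D}(\delta_x,\delta_y)=\infty$ for all $x\ne y$ in $\mathbb S^2$; 3. $d^{(\ell)}_{\mathcal A,D}(\varphi^\sharp,\psi^\sharp)<\infty$ for all states $\varphi,\psi$ of $\mathcal A_\ell$. -/

import Mathlib

open MeasureTheory Module
open scoped ContDiff Manifold ENNReal ComplexOrder Matrix

noncomputable section

namespace FuzzySphere

/-! ### States and spectral distances -/

/-- A state of a unital complex `*`-algebra: a positive linear functional with `φ 1 = 1`. -/
def IsState {A : Type*} [Ring A] [StarRing A] [Algebra ℂ A] (φ : A →ₗ[ℂ] ℂ) : Prop :=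
  (∀ a : A, 0 ≤ φ (star a * a)) ∧ φ 1 = 1

/-- The distance dual to a seminorm `L`: the supremum of `φ a - ψ a` over self-adjoint `a` with
`L a ≤ 1`. States are real on self-adjoint elements, so taking the real part changes nothing. -/
def dualDist {A : Type*} [Ring A] [StarRing A] [Algebra ℂ A] (L : A → ℝ≥0∞)
    (φ ψ : A →ₗ[ℂ] ℂ) : EReal :=
  ⨆ (a : A) (_ : IsSelfAdjoint a ∧ L a ≤ 1), (((φ a - ψ a).re : ℝ) : EReal)

/-! ### The canonical spectral triple of the sphere -/

/-- The unit sphere in Euclidean 3-space. -/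
abbrev S2 : Type := Metric.sphere (0 : EuclideanSpace ℝ (Fin 3)) 1

/-- The rotation-invariant probability measure on the sphere. -/
def sphereMeasure : Measure S2 :=
  ((volume : Measure (EuclideanSpace ℝ (Fin 3))).toSphere Set.univ)⁻¹ •
    (volume : Measure (EuclideanSpace ℝ (Fin 3))).toSphere

/-- The algebra of smooth complex functions on the sphere, as a `*`-subalgebra of the continuous
functions. -/
def smoothAlg : StarSubalgebra ℂ C(S2, ℂ) where
  carrier := {f | ContMDiff (𝓡 2) 𝓘(ℝ, ℂ) ∞ (f : S2 → ℂ)}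
  mul_mem' {f g} hf hg := by
    have h : ContDiff ℝ ∞ (fun p : ℂ × ℂ => p.1 * p.2) := contDiff_fst.mul contDiff_snd
    exact h.contMDiff.comp (hf.prodMk_space hg)
  add_mem' {f g} hf hg := by
    have h : ContDiff ℝ ∞ (fun p : ℂ × ℂ => p.1 + p.2) := contDiff_fst.add contDiff_snd
    exact h.contMDiff.comp (hf.prodMk_space hg)
  algebraMap_mem' c := contMDiff_const
  star_mem' {f} hf := by
    have h : ContDiff ℝ ∞ (fun z : ℂ => star z) := Complex.conjCLE.contDiff
    exact h.contMDiff.comp hf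

/-- Rotation by the angle `t` about the `j`-th coordinate axis (right-handed), in coordinates. -/
def rotVec (j : Fin 3) (t : ℝ) (v : EuclideanSpace ℝ (Fin 3)) : EuclideanSpace ℝ (Fin 3) :=
  match j with
  | 0 => !₂[v 0, v 1 * Real.cos t - v 2 * Real.sin t, v 1 * Real.sin t + v 2 * Real.cos t]
  | 1 => !₂[v 2 * Real.sin t + v 0 * Real.cos t, v 1, v 2 * Real.cos t - v 0 * Real.sin t]
  | 2 => !₂[v 0 * Real.cos t - v 1 * Real.sin t, v 0 * Real.sin t + v 1 * Real.cos t, v 2]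

theorem norm_rotVec (j : Fin 3) (t : ℝ) (v : EuclideanSpace ℝ (Fin 3)) :
    ‖rotVec j t v‖ = ‖v‖ := by
  have h := Real.sin_sq_add_cos_sq t
  rw [EuclideanSpace.norm_eq, EuclideanSpace.norm_eq]
  congr 1
  fin_cases j <;> simp [rotVec, Fin.sum_univ_three]
  · linear_combination (v 1 ^ 2 + v 2 ^ 2) * h
  · linear_combination (v 2 ^ 2 + v 0 ^ 2) * h
  · linear_combination (v 0 ^ 2 + v 1 ^ 2) * h

/-- Rotation by the angle `t` about the `j`-th coordinate axis, acting on the sphere. -/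
def rot (j : Fin 3) (t : ℝ) (x : S2) : S2 :=
  ⟨rotVec j t x, by
    have hx : ‖(x : EuclideanSpace ℝ (Fin 3))‖ = 1 := by simp
    simp [norm_rotVec, hx]⟩

/-- The angular momentum operator `L_j = -i (x × ∇)_j`, that is `-i` times the derivative along
the rotations about the `j`-th axis. -/
def angMom (j : Fin 3) (f : S2 → ℂ) (x : S2) : ℂ :=
  -Complex.I * deriv (fun t : ℝ => f (rot j t x)) 0

/-- In spherical coordinates, `-i ∂/∂φ`. -/
def partialH (f : S2 → ℂ) (x : S2) : ℂ := angMom 2 f x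

/-- `L_x + i L_y`; in spherical coordinates, `e^{iφ} (∂/∂ϑ + i cot ϑ ∂/∂φ)`. -/
def partialE (f : S2 → ℂ) (x : S2) : ℂ := angMom 0 f x + Complex.I * angMom 1 f x

/-- `L_x - i L_y`; in spherical coordinates, `-e^{-iφ} (∂/∂ϑ - i cot ϑ ∂/∂φ)`. -/
def partialF (f : S2 → ℂ) (x : S2) : ℂ := angMom 0 f x - Complex.I * angMom 1 f x

/-- The Dirac operator of the sphere on `ℂ²`-valued functions. -/
def dirac (ξ : Fin 2 → S2 → ℂ) : Fin 2 → S2 → ℂ :=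
  ![fun x => (1 / 2 : ℂ) * ξ 0 x + partialH (ξ 0) x + partialF (ξ 1) x,
    fun x => partialE (ξ 0) x + ((1 / 2 : ℂ) * ξ 1 x - partialH (ξ 1) x)]

/-- The norm of a `ℂ²`-valued function in the Hilbert space `L²(S²) ⊗ ℂ²`. -/
def spinorNorm (ξ : Fin 2 → S2 → ℂ) : ℝ≥0∞ :=
  eLpNorm (fun x => (WithLp.toLp 2 (fun i => ξ i x) : EuclideanSpace ℂ (Fin 2))) 2 sphereMeasure

/-- The commutator `[D, f] ξ = D (f ξ) - f (D ξ)`. -/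
def diracComm (f : S2 → ℂ) (ξ : Fin 2 → S2 → ℂ) : Fin 2 → S2 → ℂ :=
  fun i x => dirac (fun k y => f y * ξ k y) i x - f x * dirac ξ i x

/-- The operator norm `‖[D, f]‖` on `L²(S²) ⊗ ℂ²`, computed on the dense core of smooth spinors. -/
def diracSeminorm (f : S2 → ℂ) : ℝ≥0∞ :=
  ⨆ (ξ : Fin 2 → smoothAlg) (_ : spinorNorm (fun i x => (ξ i).1 x) ≤ 1),
    spinorNorm (diracComm f (fun i x => (ξ i).1 x))

/-- The spectral distance `d_{A,D}` of the sphere. -/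
def sphereDist (φ ψ : smoothAlg →ₗ[ℂ] ℂ) : EReal :=
  dualDist (fun f : smoothAlg => diracSeminorm (f.1 : S2 → ℂ)) φ ψ

/-- The pure state `δ_x`, evaluation at `x`. -/
def pointEval (x : S2) : smoothAlg →ₗ[ℂ] ℂ where
  toFun f := f.1 x
  map_add' _ _ := rfl
  map_smul' _ _ := rfl

/-! ### The fuzzy sphere of spin `ℓ = N / 2`

The basis vector `|ℓ, m⟩` of the spin `ℓ` representation has index `k = ℓ + m ∈ {0, …, N}`. -/

/-- The algebra `A_ℓ = End(V_ℓ)`. -/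
abbrev FuzzyAlg (N : ℕ) : Type := Matrix (Fin (N + 1)) (Fin (N + 1)) ℂ

/-- `ρ(H) |ℓ, m⟩ = m |ℓ, m⟩`. -/
def rhoH (N : ℕ) : FuzzyAlg N := Matrix.diagonal fun k => ((k : ℕ) : ℂ) - (N : ℂ) / 2

/-- `ρ(E) |ℓ, m⟩ = √((ℓ - m) (ℓ + m + 1)) |ℓ, m + 1⟩`. -/
def rhoE (N : ℕ) : FuzzyAlg N := Matrix.of fun i k =>
  if (i : ℕ) = (k : ℕ) + 1 then
    ((Real.sqrt (((N : ℝ) - ((k : ℕ) : ℝ)) * (((k : ℕ) : ℝ) + 1)) : ℝ) : ℂ)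
  else 0

/-- `ρ(F) = ρ(E)*`. -/
def rhoF (N : ℕ) : FuzzyAlg N := (rhoE N)ᴴ

/-- The truncated Dirac operator `D_ℓ` on `V_ℓ ⊗ ℂ² = V_ℓ ⊕ V_ℓ`. -/
def fuzzyDirac (N : ℕ) : Matrix (Fin (N + 1) ⊕ Fin (N + 1)) (Fin (N + 1) ⊕ Fin (N + 1)) ℂ :=
  Matrix.fromBlocks ((1 / 2 : ℂ) • 1 + rhoH N) (rhoF N) (rhoE N) ((1 / 2 : ℂ) • 1 - rhoH N)

/-- `a ⊗ id` on `V_ℓ ⊗ ℂ²`. -/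
def amplify (N : ℕ) (a : FuzzyAlg N) :
    Matrix (Fin (N + 1) ⊕ Fin (N + 1)) (Fin (N + 1) ⊕ Fin (N + 1)) ℂ :=
  Matrix.fromBlocks a 0 0 a

/-- The operator norm `‖[D_ℓ, a]‖` on the Hilbert space `V_ℓ ⊗ ℂ²`. -/
def fuzzySeminorm (N : ℕ) (a : FuzzyAlg N) : ℝ≥0∞ :=
  ‖Matrix.toEuclideanCLM (n := Fin (N + 1) ⊕ Fin (N + 1)) (𝕜 := ℂ)
    (fuzzyDirac N * amplify N a - amplify N a * fuzzyDirac N)‖ₑ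

/-- The spectral distance of the fuzzy sphere. -/
def fuzzyDist (N : ℕ) (φ ψ : FuzzyAlg N →ₗ[ℂ] ℂ) : EReal :=
  dualDist (fuzzySeminorm N) φ ψ

/-! ### Coherent states and Berezin quantization -/

/-- The polar angle `ϑ ∈ [0, π]`. -/
def polar (x : S2) : ℝ := Real.arccos (x.1 2)

/-- The azimuthal angle `φ`, `x₀ + i x₁ = e^{iφ} sin ϑ` (irrelevant at the poles). -/
def azimuth (x : S2) : ℝ := Complex.arg ⟨x.1 0, x.1 1⟩

/-- The coherent state projection `Q_{x;ℓ}`; rows and columns are indexed by `ℓ + m` and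
`ℓ + n`. -/
def coherentProj (N : ℕ) (x : S2) : FuzzyAlg N := Matrix.of fun k j =>
  ((Real.sqrt (N.choose (k : ℕ)) * Real.sqrt (N.choose (j : ℕ)) : ℝ) : ℂ) *
    Complex.exp (Complex.I * ((((j : ℕ) : ℝ) - ((k : ℕ) : ℝ) : ℝ) : ℂ) * (azimuth x : ℂ)) *
    ((Real.sin (polar x / 2) ^ ((k : ℕ) + (j : ℕ)) *
      Real.cos (polar x / 2) ^ (2 * N - (k : ℕ) - (j : ℕ)) : ℝ) : ℂ)

/-- The covariant Berezin symbol `σ_ℓ(a)(x) = Tr(Q_{x;ℓ} a)`. -/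
def symbol (N : ℕ) (a : FuzzyAlg N) (x : S2) : ℂ := (coherentProj N x * a).trace

instance : IsFiniteMeasure sphereMeasure := by
  unfold sphereMeasure
  refine ⟨?_⟩
  rw [Measure.smul_apply, smul_eq_mul]
  exact lt_of_le_of_lt (ENNReal.inv_mul_le_one _) ENNReal.one_lt_top

theorem measurable_coherentProj (N : ℕ) (k j : Fin (N + 1)) :
    Measurable fun x => coherentProj N x k j := by
  have hc (i : Fin 3) : Measurable fun x : S2 => x.1 i :=
    (((EuclideanSpace.proj (𝕜 := ℝ) i).continuous).comp continuous_subtype_val).measurable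
  have hp : Measurable polar := Real.measurable_arccos.comp (hc 2)
  have ha : Measurable azimuth :=
    Complex.measurable_arg.comp
      (Complex.measurableEquivRealProd.symm.measurable.comp ((hc 0).prodMk (hc 1)))
  simp only [coherentProj, Matrix.of_apply]
  fun_prop

theorem integrable_mul_coherentProj (N : ℕ) (f : C(S2, ℂ)) (k j : Fin (N + 1)) :
    Integrable (fun x => f x * coherentProj N x k j) sphereMeasure := by
  refine Integrable.of_bound
    ((f.continuous.measurable.mul (measurable_coherentProj N k j)).aestronglyMeasurable)
    (‖f‖ * (Real.sqrt (N.choose (k : ℕ)) * Real.sqrt (N.choose (j : ℕ)))) (Filter.Eventually.of_forall ?_)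
  intro x
  have he : ‖Complex.exp (Complex.I * ((((j : ℕ) : ℝ) - ((k : ℕ) : ℝ) : ℝ) : ℂ) * (azimuth x : ℂ))‖ = 1 := by
    have : Complex.I * ((((j : ℕ) : ℝ) - ((k : ℕ) : ℝ) : ℝ) : ℂ) * (azimuth x : ℂ)
        = ((((((j : ℕ) : ℝ) - ((k : ℕ) : ℝ)) * azimuth x) : ℝ) : ℂ) * Complex.I := by push_cast; ring
    rw [this, Complex.norm_exp_ofReal_mul_I]
  have hs : |Real.sin (polar x / 2)| ^ ((k : ℕ) + (j : ℕ)) ≤ 1 :=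
    pow_le_one₀ (abs_nonneg _) (Real.abs_sin_le_one _)
  have hco : |Real.cos (polar x / 2)| ^ (2 * N - (k : ℕ) - (j : ℕ)) ≤ 1 :=
    pow_le_one₀ (abs_nonneg _) (Real.abs_cos_le_one _)
  rw [norm_mul]
  refine mul_le_mul (f.norm_coe_le_norm x) ?_ (norm_nonneg _) (norm_nonneg _)
  simp only [coherentProj, Matrix.of_apply]
  rw [norm_mul, norm_mul, he, mul_one, Complex.norm_real, Complex.norm_real, Real.norm_eq_abs,
    Real.norm_eq_abs, abs_mul (Real.sin _ ^ _), abs_pow, abs_pow, abs_of_nonneg (by positivity)]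
  exact mul_le_of_le_one_right (by positivity) (mul_le_one₀ hs (by positivity) hco)

/-- The quantization map `π_ℓ(f) = (2ℓ + 1) ∫ f(x) Q_{x;ℓ} dμ`; see `inner_quantize` for its
characterization as the adjoint of the symbol map. -/
def quantize (N : ℕ) : smoothAlg →ₗ[ℂ] FuzzyAlg N where
  toFun f := Matrix.of fun k j =>
    ((N : ℂ) + 1) * ∫ x, f.1 x * coherentProj N x k j ∂sphereMeasure
  map_add' f g := by
    ext k j
    simp only [Matrix.of_apply, Matrix.add_apply, ← mul_add]
    rw [← integral_add (integrable_mul_coherentProj N f.1 k j)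
      (integrable_mul_coherentProj N g.1 k j)]
    exact congrArg _ (integral_congr_ae (Filter.Eventually.of_forall fun x => add_mul _ _ _))
  map_smul' c f := by
    ext k j
    simp only [Matrix.of_apply, Matrix.smul_apply, smul_eq_mul, RingHom.id_apply]
    rw [mul_left_comm, ← integral_const_mul c]
    exact congrArg _ (integral_congr_ae (Filter.Eventually.of_forall fun x =>
      mul_assoc c (f.1 x) (coherentProj N x k j)))

theorem coherentProj_conjTranspose (N : ℕ) (x : S2) : (coherentProj N x)ᴴ = coherentProj N x := by
  ext k j
  simp only [coherentProj, Matrix.conjTranspose_apply, Matrix.of_apply, star_mul',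
    Complex.star_def, Complex.conj_ofReal, ← Complex.exp_conj, map_mul, Complex.conj_I]
  rw [mul_comm (Real.sqrt _), add_comm (j : ℕ), Nat.sub_right_comm]
  congr 3
  push_cast
  ring

/-- The quantization map is the adjoint of the symbol map, for the `L²` inner product on functions
and the inner product `(2ℓ + 1)⁻¹ Tr(A* B)` on `A_ℓ`. -/
theorem inner_quantize (N : ℕ) (f : smoothAlg) (a : FuzzyAlg N) :
    ∫ x, star (f.1 x) * symbol N a x ∂sphereMeasure =
      ((N : ℂ) + 1)⁻¹ * ((quantize N f)ᴴ * a).trace := by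
  have hN : ((N : ℂ) + 1) ≠ 0 := by exact_mod_cast N.succ_ne_zero
  have hq (x : S2) (k j) : coherentProj N x k j = star (coherentProj N x j k) :=
    (congrFun (congrFun (coherentProj_conjTranspose N x) k) j).symm
  have hi (k j : Fin (N + 1)) :
      Integrable (fun x => star (f.1 x) * (coherentProj N x k j * a j k)) sphereMeasure := by
    have := (integrable_mul_coherentProj N (star f.1) k j).mul_const (a j k)
    simpa only [mul_assoc, ContinuousMap.star_apply] using this
  have hs (x : S2) : star (f.1 x) * symbol N a x =
      ∑ k, ∑ j, star (f.1 x) * (coherentProj N x k j * a j k) := by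
    simp only [symbol, Matrix.trace, Matrix.diag, Matrix.mul_apply, Finset.mul_sum]
  simp only [hs]
  rw [integral_finsetSum _ fun k _ => integrable_finsetSum _ fun j _ => hi k j]
  simp only [Matrix.trace, Matrix.diag, Matrix.mul_apply, Finset.mul_sum]
  refine Finset.sum_congr rfl fun k _ => ?_
  rw [integral_finsetSum _ fun j _ => hi k j]
  refine Finset.sum_congr rfl fun j _ => ?_
  have h1 : ∫ x, star (f.1 x) * (coherentProj N x k j * a j k) ∂sphereMeasure =
      star (∫ x, f.1 x * coherentProj N x j k ∂sphereMeasure) * a j k := by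
    rw [Complex.star_def, ← integral_conj, ← integral_mul_const]
    refine integral_congr_ae (Filter.Eventually.of_forall fun x => ?_)
    simp only [map_mul, ← Complex.star_def]
    rw [← hq x k j, mul_assoc]
  rw [h1, Matrix.conjTranspose_apply]
  simp only [quantize, LinearMap.coe_mk, AddHom.coe_mk, Matrix.of_apply, star_mul']
  have : star ((N : ℂ) + 1) = (N : ℂ) + 1 := by simp
  rw [this, mul_assoc, inv_mul_cancel_left₀ hN]

/-- The Berezin transform `B_ℓ = σ_ℓ ∘ π_ℓ`. -/
def berezin (N : ℕ) (f : smoothAlg) : S2 → ℂ := symbol N (quantize N f)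

/-- The pull-back `φ^♯ = φ ∘ π_ℓ`. -/
def sharp (N : ℕ) (φ : FuzzyAlg N →ₗ[ℂ] ℂ) : smoothAlg →ₗ[ℂ] ℂ := φ ∘ₗ quantize N

/-- The lower distance `d^♭_{A,D}(φ, ψ) = d_{A,D}(φ^♯, ψ^♯)`. -/
def flatDist (N : ℕ) (φ ψ : FuzzyAlg N →ₗ[ℂ] ℂ) : EReal :=
  sphereDist (sharp N φ) (sharp N ψ)

/-- The Berezin distance `d^{(ℓ)}_{A,D}`, dual to the seminorm `f ↦ ‖[D, B_ℓ(f)]‖`. -/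
def berezinDist (N : ℕ) (φ ψ : smoothAlg →ₗ[ℂ] ℂ) : EReal :=
  dualDist (fun f : smoothAlg => diracSeminorm (berezin N f)) φ ψ

end FuzzySphere

end

/-!
The three rotation groups of the sphere act on everything in sight, and the theorem follows from
the equivariance of the symbol map `σ` and the quantization map `π`.

Write `L_j` for the angular momentum operators and `J_j` for the generators of the spin `ℓ`
representation. Each `Q_x` is the projection onto the `2ℓ`-th symmetric power of a unit spinor
lying over `x` in the Hopf fibration (`coherentProj_eq_of_isSpinor`), and the rotations lift to
spinors (`exists_spinor_curve`), so `L_j σ(a) = σ([J_j, a])` (`angMom_symbol`). Since `π` is the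
transpose of `σ` and the measure is invariant, integration by parts gives `π(L_j f) = [J_j, π(f)]`
(`quantize_angMom`). Schur's lemma then yields the resolution of the identity `π(1) = 1`
(`quantize_one`). In terms of raising and lowering operators the two representations correspond
under `E ↦ -E`, `F ↦ -F`, `H ↦ H`; on `ℂ²` this is conjugation by `diag (1, -1)`, which changes no
norm.

The operator `[D, f]` is multiplication by a matrix of first derivatives of `f`, and its norm is the
supremum of the pointwise norms (`diracSeminorm_le_one_iff`). Compression to coherent vectors gives
`‖[D, σ(a)]‖ ≤ ‖[D_ℓ, a]‖` (`diracSeminorm_symbol_le_one`), and contractivity of quantization on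
matrix valued functions gives `‖[D_ℓ, π(f)]‖ ≤ ‖[D, f]‖` (`fuzzySeminorm_quantize_le_one`). The
latter is the first inequality between the distances. In a stereographic coordinate `ζ` a symbol is,
up to a nonvanishing factor, a polynomial in `ζ` and `conj ζ`, hence `σ` is injective, `π ∘ σ` is positive definite and `π` is
surjective (`quantize_symbolAlg_bijective`); lifting `a` to `f` with `π(f) = a` gives the second
inequality.

The kernel of `π` has finite codimension and separates points (`exists_quantize_eq_zero_ne`), and on
it the Berezin seminorm vanishes, so distinct points are infinitely far apart. A difference of
pulled back states factors through `a = π(f)` and kills the scalars, which are exactly the `a` for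
which all `L_j σ(a)` vanish; on the finite dimensional algebra it is therefore bounded by the
seminorm (`berezinDist_sharp_lt_top`).
-/

open MeasureTheory Module
open scoped ContDiff Manifold ENNReal ComplexOrder Matrix Pointwise ComplexConjugate

noncomputable section

namespace FuzzySphere

/-! ### Rotations and smooth functions -/

instance finrank_euclideanSpace_three : Fact (finrank ℝ (EuclideanSpace ℝ (Fin 3)) = 2 + 1) :=
  ⟨finrank_euclideanSpace_fin⟩

theorem contDiff_rotVec (j : Fin 3) :
    ContDiff ℝ ∞ (fun p : ℝ × EuclideanSpace ℝ (Fin 3) => rotVec j p.1 p.2) := by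
  have hc (i : Fin 3) : ContDiff ℝ ∞ fun p : ℝ × EuclideanSpace ℝ (Fin 3) => p.2 i :=
    (EuclideanSpace.proj (𝕜 := ℝ) i).contDiff.comp contDiff_snd
  have hs : ContDiff ℝ ∞ fun p : ℝ × EuclideanSpace ℝ (Fin 3) => Real.sin p.1 :=
    Real.contDiff_sin.comp contDiff_fst
  have hco : ContDiff ℝ ∞ fun p : ℝ × EuclideanSpace ℝ (Fin 3) => Real.cos p.1 :=
    Real.contDiff_cos.comp contDiff_fst
  rw [contDiff_euclidean]
  intro i
  fin_cases j <;> fin_cases i <;> simp [rotVec] <;>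
    first
    | exact hc _
    | exact ((hc _).mul hco).sub ((hc _).mul hs)
    | exact ((hc _).mul hs).add ((hc _).mul hco)

theorem contMDiff_rot (j : Fin 3) :
    ContMDiff (𝓘(ℝ, ℝ).prod (𝓡 2)) (𝓡 2) ∞ (fun p : ℝ × S2 => rot j p.1 p.2) := by
  have h : ContMDiff (𝓘(ℝ, ℝ).prod (𝓡 2)) 𝓘(ℝ, EuclideanSpace ℝ (Fin 3)) ∞
      (fun p : ℝ × S2 => rotVec j p.1 (p.2 : EuclideanSpace ℝ (Fin 3))) :=
    (contDiff_rotVec j).contMDiff.comp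
      (contMDiff_fst.prodMk_space (contMDiff_coe_sphere.comp contMDiff_snd))
  exact ContMDiff.codRestrict_sphere h _

theorem rot_zero (j : Fin 3) (x : S2) : rot j 0 x = x := by
  ext i
  fin_cases j <;> fin_cases i <;> simp [rot, rotVec]

theorem rot_add (j : Fin 3) (s t : ℝ) (x : S2) : rot j (s + t) x = rot j s (rot j t x) := by
  ext i
  fin_cases j <;> fin_cases i <;> simp [rot, rotVec, Real.sin_add, Real.cos_add] <;> ring

/-- Joint smoothness of `(t, x) ↦ f (rot j t x)` makes the derivative at `t = 0` smooth in `x`. -/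
theorem contMDiff_deriv_rot (j : Fin 3) (f : smoothAlg) :
    ContMDiff (𝓡 2) 𝓘(ℝ, ℂ) ∞ (fun x : S2 => deriv (fun t : ℝ => f.1 (rot j t x)) 0) := by
  intro x₀
  have hf : ContMDiff ((𝓡 2).prod 𝓘(ℝ, ℝ)) 𝓘(ℝ, ℂ) ∞
      (Function.uncurry fun (x : S2) (t : ℝ) => f.1 (rot j t x)) :=
    (show ContMDiff (𝓡 2) 𝓘(ℝ, ℂ) ∞ (f.1 : S2 → ℂ) from f.2).comp
      ((contMDiff_rot j).comp (contMDiff_snd.prodMk contMDiff_fst))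
  have h := ContMDiffAt.mfderiv (m := ∞) (n := ∞) (x₀ := x₀)
    (fun (x : S2) (t : ℝ) => f.1 (rot j t x)) (fun _ => (0 : ℝ))
    hf.contMDiffAt contMDiffAt_const (by simp)
  have h' := (ContinuousLinearMap.apply ℝ ℂ (1 : ℝ)).contDiff.contMDiff.contMDiffAt.comp x₀ h
    (n := ∞)
  refine h'.congr_of_eventuallyEq (Filter.Eventually.of_forall fun x => ?_)
  simp [inTangentCoordinates_model_space, mfderiv_eq_fderiv]

theorem differentiable_comp_rot (j : Fin 3) (f : smoothAlg) (x : S2) :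
    Differentiable ℝ (fun t : ℝ => f.1 (rot j t x)) := by
  have hf : ContMDiff 𝓘(ℝ, ℝ) 𝓘(ℝ, ℂ) ∞ (fun t : ℝ => f.1 (rot j t x)) :=
    (show ContMDiff (𝓡 2) 𝓘(ℝ, ℂ) ∞ (f.1 : S2 → ℂ) from f.2).comp
      ((contMDiff_rot j).comp (contMDiff_id.prodMk contMDiff_const))
  exact hf.contDiff.differentiable (by simp)

/-- The angular momentum operator as a map of the algebra of smooth functions. -/
def angMomAlg (j : Fin 3) (f : smoothAlg) : smoothAlg :=
  ⟨⟨angMom j f.1, continuous_const.mul (contMDiff_deriv_rot j f).continuous⟩,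
    (contDiff_const.mul contDiff_id : ContDiff ℝ ∞ fun z : ℂ => -Complex.I * z).contMDiff.comp
      (contMDiff_deriv_rot j f)⟩

theorem continuous_angMom (j : Fin 3) (f : smoothAlg) : Continuous (angMom j f.1) :=
  (angMomAlg j f).1.continuous

theorem hasDerivAt_comp_rot (j : Fin 3) (f : smoothAlg) (x : S2) (t : ℝ) :
    HasDerivAt (fun s : ℝ => f.1 (rot j s x)) (Complex.I * angMom j f.1 (rot j t x)) t := by
  have h := ((differentiable_comp_rot j f (rot j t x)) 0).hasDerivAt
  have h2 : HasDerivAt (fun s : ℝ => f.1 (rot j (s - t) (rot j t x)))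
      (deriv (fun s : ℝ => f.1 (rot j s (rot j t x))) 0) t := by
    refine HasDerivAt.comp_sub_const t t (f := fun s : ℝ => f.1 (rot j s (rot j t x))) ?_
    rwa [sub_self]
  have h3 (s : ℝ) : rot j (s - t) (rot j t x) = rot j s x := by rw [← rot_add, sub_add_cancel]
  simp only [h3] at h2
  convert h2 using 1
  rw [angMom, ← mul_assoc]
  simp

theorem angMom_eq_of_hasDerivAt {j : Fin 3} {f : S2 → ℂ} {x : S2} {c : ℂ}
    (h : HasDerivAt (fun t : ℝ => f (rot j t x)) c 0) : angMom j f x = -Complex.I * c := by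
  rw [angMom, h.deriv]

theorem angMom_mul (j : Fin 3) (f g : smoothAlg) (x : S2) :
    angMom j (fun y => f.1 y * g.1 y) x =
      angMom j f.1 x * g.1 x + f.1 x * angMom j g.1 x := by
  have h := (hasDerivAt_comp_rot j f x 0).mul (hasDerivAt_comp_rot j g x 0)
  rw [angMom_eq_of_hasDerivAt h]
  simp only [rot_zero]
  linear_combination (-(angMom j f.1 x * g.1 x + f.1 x * angMom j g.1 x)) * Complex.I_mul_I

/-! ### The invariant measure -/

instance : IsProbabilityMeasure sphereMeasure := by
  constructor
  rw [sphereMeasure, Measure.smul_apply, smul_eq_mul]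
  refine ENNReal.inv_mul_cancel ?_ (measure_ne_top _ _)
  rw [Ne, Measure.measure_univ_eq_zero]
  exact Measure.toSphere_ne_zero _

instance : sphereMeasure.IsOpenPosMeasure :=
  Measure.isOpenPosMeasure_smul _ (ENNReal.inv_ne_zero.2 (measure_ne_top _ _))

/-- Rotation about a coordinate axis as a linear isometry of the ambient space. -/
def rotIso (j : Fin 3) (t : ℝ) : EuclideanSpace ℝ (Fin 3) →ₗᵢ[ℝ] EuclideanSpace ℝ (Fin 3) where
  toFun := rotVec j t
  map_add' v w := by
    ext i
    fin_cases j <;> fin_cases i <;> simp [rotVec] <;> ring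
  map_smul' c v := by
    ext i
    fin_cases j <;> fin_cases i <;> simp [rotVec] <;> ring
  norm_map' := norm_rotVec j t

theorem continuous_rot (j : Fin 3) (t : ℝ) : Continuous (rot j t) :=
  (contMDiff_rot j).continuous.comp (continuous_const.prodMk continuous_id)

theorem measurePreserving_rot (j : Fin 3) (t : ℝ) :
    MeasurePreserving (rot j t) sphereMeasure sphereMeasure := by
  have hm : Measurable (rot j t) := (continuous_rot j t).measurable
  refine MeasurePreserving.smul_measure ⟨hm, ?_⟩ _
  ext s hs
  rw [Measure.map_apply hm hs, Measure.toSphere_apply' _ (hm hs), Measure.toSphere_apply' _ hs]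
  congr 1
  let e := LinearIsometry.toLinearIsometryEquiv (rotIso j t) rfl
  -- The measure of `s` is a multiple of the volume of the cone over `s`, which `e` rotates.
  have hp : MeasurePreserving e volume volume := e.measurePreserving
  refine Eq.trans ?_ (hp.measure_preimage_emb e.toHomeomorph.measurableEmbedding _)
  congr 1
  ext v
  simp only [Set.mem_preimage, Set.mem_smul, Set.mem_image, exists_exists_and_eq_and]
  constructor
  · rintro ⟨r, hr, y, hy, rfl⟩
    exact ⟨r, hr, rot j t y, hy, ((rotIso j t).map_smul r (y : EuclideanSpace ℝ (Fin 3))).symm⟩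
  · rintro ⟨r, hr, y, hy, h⟩
    have hy' : rot j t (rot j (-t) y) = y := by rw [← rot_add, add_neg_cancel, rot_zero]
    refine ⟨r, hr, rot j (-t) y, by rwa [hy'], (rotIso j t).injective ?_⟩
    rw [map_smul]
    refine Eq.trans ?_ h
    exact congrArg (fun z : S2 => r • (z : EuclideanSpace ℝ (Fin 3))) hy'

/-- The derivative along rotations integrates to zero, by invariance of the measure. -/
theorem integral_angMom (j : Fin 3) (f : smoothAlg) :
    ∫ x, angMom j f.1 x ∂sphereMeasure = 0 := by
  obtain ⟨C, hC⟩ : ∃ C, ∀ x, ‖angMom j f.1 x‖ ≤ C :=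
    ⟨‖(angMomAlg j f).1‖, fun x => (angMomAlg j f).1.norm_coe_le_norm x⟩
  have hi (t : ℝ) : ∫ x, f.1 (rot j t x) ∂sphereMeasure = ∫ x, f.1 x ∂sphereMeasure := by
    have h := integral_map (μ := sphereMeasure) (continuous_rot j t).measurable.aemeasurable
      (f := f.1) f.1.continuous.aestronglyMeasurable
    rw [← h, (measurePreserving_rot j t).map_eq]
  have h := hasDerivAt_integral_of_dominated_loc_of_deriv_le (μ := sphereMeasure) (𝕜 := ℝ)
    (F := fun t x => f.1 (rot j t x)) (F' := fun t x => Complex.I * angMom j f.1 (rot j t x))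
    (x₀ := 0) (s := Set.univ) (bound := fun _ => C) Filter.univ_mem
    (Filter.Eventually.of_forall fun t =>
      (f.1.continuous.comp (continuous_rot j t)).aestronglyMeasurable)
    ((f.1.continuous.comp (continuous_rot j 0)).integrable_of_hasCompactSupport
      (HasCompactSupport.of_compactSpace _))
    ((continuous_const.mul ((continuous_angMom j f).comp
      (continuous_rot j 0))).aestronglyMeasurable)
    (Filter.Eventually.of_forall fun x t _ => by simpa using hC _)
    (integrable_const C)
    (Filter.Eventually.of_forall fun x t _ => hasDerivAt_comp_rot j f x t)
  have h2 := h.2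
  simp only [hi, rot_zero] at h2
  have h3 := h2.unique (hasDerivAt_const (0 : ℝ) (∫ x, f.1 x ∂sphereMeasure))
  rw [integral_const_mul] at h3
  simpa using h3

theorem integrable_of_continuous {F : Type*} [NormedAddCommGroup F] {f : S2 → F}
    (hf : Continuous f) : Integrable f sphereMeasure :=
  hf.integrable_of_hasCompactSupport (HasCompactSupport.of_compactSpace _)

/-- Integration by parts for the angular momentum operators. -/
theorem integral_angMom_mul (j : Fin 3) (f g : smoothAlg) :
    ∫ x, angMom j f.1 x * g.1 x ∂sphereMeasure =
      -∫ x, f.1 x * angMom j g.1 x ∂sphereMeasure := by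
  have h : ∫ x, angMom j (fun y => f.1 y * g.1 y) x ∂sphereMeasure = 0 :=
    integral_angMom j (f * g)
  simp only [angMom_mul] at h
  rw [integral_add (f := fun x => angMom j f.1 x * g.1 x)
    (g := fun x => f.1 x * angMom j g.1 x)
    (integrable_of_continuous ((continuous_angMom j f).mul g.1.continuous))
    (integrable_of_continuous (f.1.continuous.mul (continuous_angMom j g)))] at h
  exact eq_neg_of_add_eq_zero_left h

/-! ### Coherent states and spinors -/

/-- The coherent vector attached to the spinor `(z, w)`: the `N`-th symmetric power of `(z, w)`. -/
def coherentVec (N : ℕ) (z w : ℂ) : Fin (N + 1) → ℂ := fun k =>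
  ((Real.sqrt (N.choose (k : ℕ)) : ℝ) : ℂ) * (z ^ (N - (k : ℕ)) * w ^ (k : ℕ))

/-- The unit spinor `(z, w)` lies over `x` in the Hopf fibration. -/
structure IsSpinor (z w : ℂ) (x : S2) : Prop where
  fst : z * conj z = (1 + (x.1 2 : ℂ)) / 2
  snd : w * conj w = (1 - (x.1 2 : ℂ)) / 2
  cross : z * conj w = ((x.1 0 : ℂ) + Complex.I * (x.1 1 : ℂ)) / 2

/-- The complex conjugate of `IsSpinor.cross`. -/
theorem IsSpinor.cross' {z w : ℂ} {x : S2} (h : IsSpinor z w x) :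
    w * conj z = ((x.1 0 : ℂ) - Complex.I * (x.1 1 : ℂ)) / 2 := by
  have := congrArg conj h.cross
  simp only [map_mul, map_div₀, map_add, Complex.conj_conj, Complex.conj_ofReal, Complex.conj_I,
    map_ofNat] at this
  linear_combination this

theorem sum_sq_coord (x : S2) : x.1 0 ^ 2 + x.1 1 ^ 2 + x.1 2 ^ 2 = 1 := by
  have h : ‖(x : EuclideanSpace ℝ (Fin 3))‖ = 1 := by simp
  rw [EuclideanSpace.norm_eq, Real.sqrt_eq_one, Fin.sum_univ_three] at h
  simpa using h

/-- The spinor read off from the spherical coordinates of `x`. -/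
theorem isSpinor_polar (x : S2) :
    IsSpinor (Real.cos (polar x / 2) : ℂ)
      ((Real.sin (polar x / 2) : ℂ) * Complex.exp (-(Complex.I * (azimuth x : ℂ)))) x := by
  have hx := sum_sq_coord x
  have hcos : Real.cos (polar x) = x.1 2 :=
    Real.cos_arccos (by nlinarith [sq_nonneg (x.1 0), sq_nonneg (x.1 1)])
      (by nlinarith [sq_nonneg (x.1 0), sq_nonneg (x.1 1)])
  have h2 : polar x = 2 * (polar x / 2) := by ring
  have hcos2 : x.1 2 = 2 * Real.cos (polar x / 2) ^ 2 - 1 := by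
    rw [← hcos, ← Real.cos_two_mul, ← h2]
  have hsc := Real.sin_sq_add_cos_sq (polar x / 2)
  have hsin : 2 * Real.sin (polar x / 2) * Real.cos (polar x / 2) =
      ‖(⟨x.1 0, x.1 1⟩ : ℂ)‖ := by
    rw [← Real.sin_two_mul, ← h2, polar, Real.sin_arccos, Complex.norm_def, Complex.normSq_mk]
    congr 1
    linarith
  have hexp : conj (Complex.exp (-(Complex.I * (azimuth x : ℂ)))) =
      Complex.exp ((azimuth x : ℂ) * Complex.I) := by
    rw [← Complex.exp_conj]
    simp [mul_comm]
  have hmul : Complex.exp (-(Complex.I * (azimuth x : ℂ))) *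
      Complex.exp ((azimuth x : ℂ) * Complex.I) = 1 := by
    rw [← Complex.exp_add, mul_comm, neg_add_cancel, Complex.exp_zero]
  have hcos3 : (x.1 2 : ℂ) = 2 * (Real.cos (polar x / 2) : ℂ) ^ 2 - 1 := by
    rw [hcos2]
    push_cast
    ring
  have hsc3 : (Real.sin (polar x / 2) : ℂ) ^ 2 + (Real.cos (polar x / 2) : ℂ) ^ 2 = 1 := by
    exact_mod_cast hsc
  refine ⟨?_, ?_, ?_⟩
  · rw [Complex.conj_ofReal]
    linear_combination (-1 / 2 : ℂ) * hcos3
  · rw [map_mul, Complex.conj_ofReal, hexp]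
    linear_combination (Real.sin (polar x / 2) : ℂ) ^ 2 * hmul + hsc3 + (1 / 2 : ℂ) * hcos3
  · rw [map_mul, Complex.conj_ofReal, hexp]
    have h4 := Complex.norm_mul_exp_arg_mul_I (⟨x.1 0, x.1 1⟩ : ℂ)
    have h5 : (⟨x.1 0, x.1 1⟩ : ℂ) = (x.1 0 : ℂ) + Complex.I * (x.1 1 : ℂ) := by
      rw [Complex.mk_eq_add_mul_I]; ring
    rw [← hsin, h5] at h4
    rw [azimuth, h5]
    push_cast at h4 ⊢
    linear_combination (1 / 2 : ℂ) * h4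

/-- The entry of `Q_x` as a polynomial in the coordinates of `x`; one of the truncated exponents
`j - k` and `k - j` is zero. -/
def coherentPoly (N k j : ℕ) (x : S2) : ℂ :=
  ((1 + (x.1 2 : ℂ)) / 2) ^ (N - max k j) * ((1 - (x.1 2 : ℂ)) / 2) ^ min k j *
    (((x.1 0 : ℂ) + Complex.I * (x.1 1 : ℂ)) / 2) ^ (j - k) *
    (((x.1 0 : ℂ) - Complex.I * (x.1 1 : ℂ)) / 2) ^ (k - j)

/-- The entries of the rank one operator of a coherent vector depend on the spinor only through its
Hopf image. -/
theorem coherentVec_mul_conj {N : ℕ} {z w : ℂ} {x : S2} (h : IsSpinor z w x)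
    (k j : Fin (N + 1)) :
    coherentVec N z w k * conj (coherentVec N z w j) =
      ((Real.sqrt (N.choose (k : ℕ)) * Real.sqrt (N.choose (j : ℕ)) : ℝ) : ℂ) *
        coherentPoly N k j x := by
  obtain ⟨k, hk⟩ := k
  obtain ⟨j, hj⟩ := j
  simp only [coherentVec, coherentPoly, ← h.fst, ← h.snd, ← h.cross, ← h.cross', map_mul, map_pow,
    Complex.conj_ofReal, Complex.ofReal_mul]
  rcases le_total k j with hkj | hkj
  · obtain ⟨d, rfl⟩ := Nat.exists_eq_add_of_le hkj
    obtain ⟨e, rfl⟩ := Nat.exists_eq_add_of_le (Nat.lt_succ_iff.1 hj)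
    have h1 : k + d + e - k = d + e := by omega
    have h2 : k + d + e - (k + d) = e := by omega
    simp only [max_eq_right hkj, min_eq_left hkj, h1, h2, Nat.add_sub_cancel_left,
      Nat.sub_eq_zero_of_le hkj]
    ring
  · obtain ⟨d, rfl⟩ := Nat.exists_eq_add_of_le hkj
    obtain ⟨e, rfl⟩ := Nat.exists_eq_add_of_le (Nat.lt_succ_iff.1 hk)
    have h1 : j + d + e - j = d + e := by omega
    have h2 : j + d + e - (j + d) = e := by omega
    simp only [max_eq_left hkj, min_eq_right hkj, h1, h2, Nat.add_sub_cancel_left,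
      Nat.sub_eq_zero_of_le hkj]
    ring

/-- `Q_x` is the rank one projection onto the coherent vector of any spinor over `x`. -/
theorem coherentProj_eq_of_isSpinor {N : ℕ} {z w : ℂ} {x : S2} (h : IsSpinor z w x)
    (k j : Fin (N + 1)) :
    coherentProj N x k j = coherentVec N z w k * conj (coherentVec N z w j) := by
  rw [coherentVec_mul_conj h, ← coherentVec_mul_conj (isSpinor_polar x)]
  have hk := Nat.lt_succ_iff.1 k.2
  have hj := Nat.lt_succ_iff.1 j.2
  have h1 : 2 * N - (k : ℕ) - (j : ℕ) = (N - (k : ℕ)) + (N - (j : ℕ)) := by omega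
  have h2 : Complex.exp (Complex.I * ((((j : ℕ) : ℝ) - ((k : ℕ) : ℝ) : ℝ) : ℂ) * (azimuth x : ℂ)) =
      Complex.exp (-(Complex.I * (azimuth x : ℂ))) ^ (k : ℕ) *
        conj (Complex.exp (-(Complex.I * (azimuth x : ℂ)))) ^ (j : ℕ) := by
    rw [← Complex.exp_conj, ← Complex.exp_nat_mul, ← Complex.exp_nat_mul, ← Complex.exp_add]
    congr 1
    simp only [map_neg, map_mul, Complex.conj_I, Complex.conj_ofReal]
    push_cast
    ring
  simp only [coherentProj, Matrix.of_apply, coherentVec, h1, h2, map_mul, map_pow,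
    Complex.conj_ofReal]
  push_cast
  ring

theorem coherentProj_eq_poly (N : ℕ) (x : S2) (k j : Fin (N + 1)) :
    coherentProj N x k j =
      ((Real.sqrt (N.choose (k : ℕ)) * Real.sqrt (N.choose (j : ℕ)) : ℝ) : ℂ) *
        coherentPoly N k j x := by
  rw [coherentProj_eq_of_isSpinor (isSpinor_polar x), coherentVec_mul_conj (isSpinor_polar x)]

theorem contMDiff_coherentProj (N : ℕ) (k j : Fin (N + 1)) :
    ContMDiff (𝓡 2) 𝓘(ℝ, ℂ) ∞ (fun x => coherentProj N x k j) := by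
  let P : EuclideanSpace ℝ (Fin 3) → ℂ := fun v =>
    ((Real.sqrt (N.choose (k : ℕ)) * Real.sqrt (N.choose (j : ℕ)) : ℝ) : ℂ) *
    (((1 + (v 2 : ℂ)) / 2) ^ (N - max (k : ℕ) j) * ((1 - (v 2 : ℂ)) / 2) ^ min (k : ℕ) j *
    (((v 0 : ℂ) + Complex.I * (v 1 : ℂ)) / 2) ^ ((j : ℕ) - k) *
    (((v 0 : ℂ) - Complex.I * (v 1 : ℂ)) / 2) ^ ((k : ℕ) - j))
  have hc (i : Fin 3) : ContDiff ℝ ∞ fun v : EuclideanSpace ℝ (Fin 3) => ((v i : ℝ) : ℂ) :=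
    Complex.ofRealCLM.contDiff.comp (EuclideanSpace.proj (𝕜 := ℝ) i).contDiff
  have hP : ContDiff ℝ ∞ P := by
    have h0 := hc 0
    have h1 := hc 1
    have h2 := hc 2
    fun_prop
  refine (hP.contMDiff.comp contMDiff_coe_sphere).congr fun x => ?_
  rw [coherentProj_eq_poly]
  rfl

theorem symbol_eq_sum (N : ℕ) (a : FuzzyAlg N) :
    symbol N a = fun x => ∑ k, ∑ j, coherentProj N x k j * a j k := by
  funext x
  simp only [symbol, Matrix.trace, Matrix.diag, Matrix.mul_apply]

theorem symbol_add (N : ℕ) (a b : FuzzyAlg N) (x : S2) :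
    symbol N (a + b) x = symbol N a x + symbol N b x := by
  rw [symbol, Matrix.mul_add, Matrix.trace_add, symbol, symbol]

theorem symbol_smul (N : ℕ) (c : ℂ) (a : FuzzyAlg N) (x : S2) :
    symbol N (c • a) x = c * symbol N a x := by
  rw [symbol, Matrix.mul_smul, Matrix.trace_smul, symbol, smul_eq_mul]

theorem symbol_sub (N : ℕ) (a b : FuzzyAlg N) (x : S2) :
    symbol N (a - b) x = symbol N a x - symbol N b x := by
  rw [symbol, Matrix.mul_sub, Matrix.trace_sub, symbol, symbol]

/-- The symbol `σ(a)` as a smooth function. -/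
def symbolAlg (N : ℕ) : FuzzyAlg N →ₗ[ℂ] smoothAlg where
  toFun a := ⟨⟨symbol N a, by
      rw [symbol_eq_sum]
      exact continuous_finsetSum _ fun k _ => continuous_finsetSum _ fun j _ =>
        (contMDiff_coherentProj N k j).continuous.mul continuous_const⟩, by
      change ContMDiff (𝓡 2) 𝓘(ℝ, ℂ) ∞ (symbol N a)
      rw [symbol_eq_sum]
      refine contMDiff_finsetSum fun k _ => contMDiff_finsetSum fun j _ => ?_
      exact (contDiff_id.mul contDiff_const :
        ContDiff ℝ ∞ fun z : ℂ => z * a j k).contMDiff.comp (contMDiff_coherentProj N k j)⟩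
  map_add' a b := by
    ext x
    exact symbol_add N a b x
  map_smul' c a := by
    ext x
    exact symbol_smul N c a x

theorem symbol_eq_of_isSpinor {N : ℕ} {z w : ℂ} {x : S2} (h : IsSpinor z w x) (a : FuzzyAlg N) :
    symbol N a x = star (coherentVec N z w) ⬝ᵥ (a *ᵥ coherentVec N z w) := by
  simp only [symbol, Matrix.trace, Matrix.diag, Matrix.mul_apply, dotProduct, Matrix.mulVec,
    Finset.mul_sum, coherentProj_eq_of_isSpinor h]
  rw [Finset.sum_comm]
  refine Finset.sum_congr rfl fun k _ => Finset.sum_congr rfl fun j _ => ?_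
  simp only [Pi.star_apply, Complex.star_def]
  ring

/-! ### Equivariance of the symbol map -/

theorem sqrt_choose_mul_sqrt (N m : ℕ) (hm : m ≤ N) :
    Real.sqrt (((N : ℝ) - (m : ℝ)) * ((m : ℝ) + 1)) * Real.sqrt (N.choose m) =
      Real.sqrt (N.choose (m + 1)) * ((m : ℝ) + 1) := by
  have h : ((N.choose (m + 1) : ℕ) : ℝ) * ((m : ℝ) + 1) = (N.choose m : ℝ) * ((N : ℝ) - m) := by
    rw [← Nat.cast_sub hm]
    exact_mod_cast Nat.choose_succ_right_eq N m
  have hm' : (0 : ℝ) ≤ (N : ℝ) - m := sub_nonneg.2 (by exact_mod_cast hm)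
  rw [← Real.sqrt_mul (by positivity)]
  conv_rhs => rw [← Real.sqrt_sq (show (0 : ℝ) ≤ (m : ℝ) + 1 by positivity)]
  rw [← Real.sqrt_mul (by positivity)]
  congr 1
  linear_combination (-(m : ℝ) - 1) * h

theorem sqrt_choose_succ_mul_sqrt (N m : ℕ) (hm : m ≤ N) :
    Real.sqrt (((N : ℝ) - (m : ℝ)) * ((m : ℝ) + 1)) * Real.sqrt (N.choose (m + 1)) =
      Real.sqrt (N.choose m) * ((N : ℝ) - m) := by
  have h : ((N.choose (m + 1) : ℕ) : ℝ) * ((m : ℝ) + 1) = (N.choose m : ℝ) * ((N : ℝ) - m) := by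
    rw [← Nat.cast_sub hm]
    exact_mod_cast Nat.choose_succ_right_eq N m
  have hm' : (0 : ℝ) ≤ (N : ℝ) - m := sub_nonneg.2 (by exact_mod_cast hm)
  rw [← Real.sqrt_mul (by positivity)]
  conv_rhs => rw [← Real.sqrt_sq hm']
  rw [← Real.sqrt_mul (by positivity)]
  congr 1
  linear_combination ((N : ℝ) - m) * h

theorem rhoE_mulVec_coherentVec (N : ℕ) (z w : ℂ) (k : Fin (N + 1)) :
    (rhoE N *ᵥ coherentVec N z w) k = ((Real.sqrt (N.choose (k : ℕ)) : ℝ) : ℂ) *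
      (z ^ (N - (k : ℕ)) * (((k : ℕ) : ℂ) * w ^ ((k : ℕ) - 1)) * z) := by
  obtain ⟨k, hk⟩ := k
  simp only [Matrix.mulVec, dotProduct, rhoE, Matrix.of_apply, ite_mul, zero_mul]
  cases k with
  | zero => simp
  | succ m =>
    rw [Finset.sum_eq_single (⟨m, by omega⟩ : Fin (N + 1))
      (fun b _ hb => if_neg fun h => hb (Fin.ext (Nat.succ.inj h).symm))
      (fun h => absurd (Finset.mem_univ _) h)]
    have h := congrArg (fun r : ℝ => (r : ℂ)) (sqrt_choose_mul_sqrt N m (by omega))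
    have h2 : N - m = N - (m + 1) + 1 := by omega
    simp only [coherentVec, if_true, Nat.add_sub_cancel, h2, pow_succ]
    push_cast at h ⊢
    linear_combination (z ^ (N - (m + 1)) * z * w ^ m) * h

theorem rhoF_mulVec_coherentVec (N : ℕ) (z w : ℂ) (k : Fin (N + 1)) :
    (rhoF N *ᵥ coherentVec N z w) k = ((Real.sqrt (N.choose (k : ℕ)) : ℝ) : ℂ) *
      (((N - (k : ℕ) : ℕ) : ℂ) * z ^ (N - (k : ℕ) - 1) * w ^ (k : ℕ) * w) := by
  obtain ⟨k, hk⟩ := k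
  simp only [Matrix.mulVec, dotProduct, rhoF, rhoE, Matrix.conjTranspose_apply, Matrix.of_apply,
    apply_ite star, star_zero, ite_mul, zero_mul, Complex.star_def, Complex.conj_ofReal]
  rcases Nat.lt_or_ge k N with hkN | hkN
  · rw [Finset.sum_eq_single (⟨k + 1, by omega⟩ : Fin (N + 1))
      (fun b _ hb => if_neg fun h => hb (Fin.ext (by omega)))
      (fun h => absurd (Finset.mem_univ _) h)]
    have h := congrArg (fun r : ℝ => (r : ℂ)) (sqrt_choose_succ_mul_sqrt N k hkN.le)
    simp only [coherentVec, if_true, Nat.sub_sub, pow_succ, Nat.cast_sub hkN.le]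
    push_cast at h ⊢
    linear_combination (z ^ (N - (k + 1)) * w ^ k * w) * h
  · have : k = N := by omega
    subst this
    rw [Finset.sum_eq_zero fun b _ => if_neg (by omega)]
    simp

/-- The generator `J_j` of the rotations about the `j`-th axis on `V_ℓ`. The raising and lowering
operators enter with a sign, because the symbol of `ρ(H)` is `-ℓ cos ϑ`. -/
def spinGen (N : ℕ) (j : Fin 3) : FuzzyAlg N :=
  match j with
  | 0 => (-1 / 2 : ℂ) • (rhoE N + rhoF N)
  | 1 => (Complex.I / 2) • (rhoE N - rhoF N)
  | 2 => rhoH N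

theorem spinGen_isHermitian (N : ℕ) (j : Fin 3) : (spinGen N j)ᴴ = spinGen N j := by
  fin_cases j
  · simp [spinGen, rhoF, add_comm]
  · simp only [spinGen, rhoF, Matrix.conjTranspose_smul, Matrix.conjTranspose_sub,
      Matrix.conjTranspose_conjTranspose]
    simp only [star_div₀, Complex.star_def, Complex.conj_I, map_ofNat, neg_div, neg_smul]
    rw [← smul_neg, neg_sub]
  · simp only [spinGen, rhoH, Matrix.diagonal_conjTranspose]
    congr 1
    ext k
    simp

theorem hasDerivAt_coherentVec {N : ℕ} {z w : ℝ → ℂ} {z' w' : ℂ} {t : ℝ}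
    (hz : HasDerivAt z z' t) (hw : HasDerivAt w w' t) (k : Fin (N + 1)) :
    HasDerivAt (fun s => coherentVec N (z s) (w s) k)
      (((Real.sqrt (N.choose (k : ℕ)) : ℝ) : ℂ) *
        ((((N - (k : ℕ) : ℕ) : ℂ) * z t ^ (N - (k : ℕ) - 1) * z') * w t ^ (k : ℕ) +
          z t ^ (N - (k : ℕ)) * (((k : ℕ) : ℂ) * w t ^ ((k : ℕ) - 1) * w'))) t :=
  ((hz.pow (N - (k : ℕ))).mul (hw.pow (k : ℕ))).const_mul _

/-- The one-parameter group of rotations about the `j`-th axis lifts to spinors, with generator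
`-i J_j` on coherent vectors. -/
theorem exists_spinor_curve (N : ℕ) (j : Fin 3) (x : S2) :
    ∃ z w : ℝ → ℂ, (∀ t, IsSpinor (z t) (w t) (rot j t x)) ∧
      ∀ k, HasDerivAt (fun t => coherentVec N (z t) (w t) k)
        (-Complex.I * (spinGen N j *ᵥ coherentVec N (z 0) (w 0)) k) 0 := by
  -- The lift of the rotation by `t` is the element of `SU(2)` with half angle `t / 2` in each case.
  obtain ⟨z, w, h⟩ : ∃ z w, IsSpinor z w x := ⟨_, _, isSpinor_polar x⟩
  have h' := h.cross'
  have hc (t : ℝ) : Real.cos t = Real.cos (t / 2) ^ 2 - Real.sin (t / 2) ^ 2 := by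
    rw [← Real.cos_two_mul', mul_div_cancel₀ _ two_ne_zero]
  have hs (t : ℝ) : Real.sin t = 2 * Real.sin (t / 2) * Real.cos (t / 2) := by
    rw [← Real.sin_two_mul, mul_div_cancel₀ _ two_ne_zero]
  have hsc (t : ℝ) : ((Real.sin (t / 2) : ℝ) : ℂ) ^ 2 + ((Real.cos (t / 2) : ℝ) : ℂ) ^ 2 = 1 := by
    exact_mod_cast Real.sin_sq_add_cos_sq (t / 2)
  have hdc : HasDerivAt (fun t : ℝ => ((Real.cos (t / 2) : ℝ) : ℂ)) 0 0 := by
    have := ((hasDerivAt_id (0 : ℝ)).div_const 2).cos.ofReal_comp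
    simpa using this
  have hds : HasDerivAt (fun t : ℝ => ((Real.sin (t / 2) : ℝ) : ℂ)) (1 / 2) 0 := by
    have := ((hasDerivAt_id (0 : ℝ)).div_const 2).sin.ofReal_comp
    simpa using this
  have hI := Complex.I_mul_I
  have hpow (n : ℕ) (u : ℂ) : (n : ℂ) * u ^ (n - 1) * u = n * u ^ n := by
    cases n with
    | zero => simp
    | succ n => simp [pow_succ, mul_assoc]
  match j with
  | 0 =>
  · refine ⟨fun t => Real.cos (t / 2) * z + Complex.I * Real.sin (t / 2) * w,
      fun t => Complex.I * Real.sin (t / 2) * z + Real.cos (t / 2) * w, fun t => ?_, fun k => ?_⟩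
    · have h1 := hsc t
      have h2 := h.fst
      have h3 := h.snd
      have h4 := h.cross
      have e0 : (rot 0 t x).1 0 = x.1 0 := rfl
      have e1 : (rot 0 t x).1 1 = x.1 1 * Real.cos t - x.1 2 * Real.sin t := rfl
      have e2 : (rot 0 t x).1 2 = x.1 1 * Real.sin t + x.1 2 * Real.cos t := rfl
      refine ⟨?_, ?_, ?_⟩
      · simp only [map_add, map_mul, Complex.conj_ofReal, Complex.conj_I, e2, hc t, hs t]
        generalize Real.cos (t / 2) = c at h1 ⊢
        generalize Real.sin (t / 2) = s at h1 ⊢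
        push_cast
        linear_combination (c : ℂ) ^ 2 * h2 - Complex.I ^ 2 * (s : ℂ) ^ 2 * h3 -
          Complex.I * (c * s : ℂ) * h4 + Complex.I * (c * s : ℂ) * h' -
          ((s : ℂ) ^ 2 * (1 - (x.1 2 : ℂ)) / 2 + (c * s : ℂ) * (x.1 1 : ℂ)) * hI + (1 / 2) * h1
      · simp only [map_add, map_mul, Complex.conj_ofReal, Complex.conj_I, e2, hc t, hs t]
        generalize Real.cos (t / 2) = c at h1 ⊢
        generalize Real.sin (t / 2) = s at h1 ⊢
        push_cast
        linear_combination -Complex.I ^ 2 * (s : ℂ) ^ 2 * h2 + (c : ℂ) ^ 2 * h3 +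
          Complex.I * (c * s : ℂ) * h4 - Complex.I * (c * s : ℂ) * h' +
          ((c * s : ℂ) * (x.1 1 : ℂ) - (s : ℂ) ^ 2 * (1 + (x.1 2 : ℂ)) / 2) * hI + (1 / 2) * h1
      · simp only [map_add, map_mul, Complex.conj_ofReal, Complex.conj_I, e0, e1, hc t, hs t]
        generalize Real.cos (t / 2) = c at h1 ⊢
        generalize Real.sin (t / 2) = s at h1 ⊢
        push_cast
        linear_combination -Complex.I * (c * s : ℂ) * h2 + Complex.I * (c * s : ℂ) * h3 +
          (c : ℂ) ^ 2 * h4 - Complex.I ^ 2 * (s : ℂ) ^ 2 * h' -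
          ((s : ℂ) ^ 2 * ((x.1 0 : ℂ) - Complex.I * (x.1 1 : ℂ)) / 2) * hI + ((x.1 0 : ℂ) / 2) * h1
    · have hz := (hdc.mul_const z).add ((hds.const_mul Complex.I).mul_const w)
      have hw := ((hds.const_mul Complex.I).mul_const z).add (hdc.mul_const w)
      refine (hasDerivAt_coherentVec hz hw k).congr_deriv ?_
      simp only [spinGen, Matrix.smul_mulVec, Matrix.add_mulVec,
        Pi.smul_apply, Pi.add_apply, rhoE_mulVec_coherentVec, rhoF_mulVec_coherentVec, smul_eq_mul]
      simp
      ring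
  | 1 =>
  · refine ⟨fun t => Real.cos (t / 2) * z - Real.sin (t / 2) * w,
      fun t => Real.sin (t / 2) * z + Real.cos (t / 2) * w, fun t => ?_, fun k => ?_⟩
    · have h1 := hsc t
      have h2 := h.fst
      have h3 := h.snd
      have h4 := h.cross
      have e0 : (rot 1 t x).1 0 = x.1 2 * Real.sin t + x.1 0 * Real.cos t := rfl
      have e1 : (rot 1 t x).1 1 = x.1 1 := rfl
      have e2 : (rot 1 t x).1 2 = x.1 2 * Real.cos t - x.1 0 * Real.sin t := rfl
      refine ⟨?_, ?_, ?_⟩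
      · simp only [map_sub, map_mul, Complex.conj_ofReal, e2, hc t, hs t]
        generalize Real.cos (t / 2) = c at h1 ⊢
        generalize Real.sin (t / 2) = s at h1 ⊢
        push_cast
        linear_combination (c : ℂ) ^ 2 * h2 + (s : ℂ) ^ 2 * h3 - (c * s : ℂ) * h4 -
          (c * s : ℂ) * h' + (1 / 2) * h1
      · simp only [map_add, map_mul, Complex.conj_ofReal, e2, hc t, hs t]
        generalize Real.cos (t / 2) = c at h1 ⊢
        generalize Real.sin (t / 2) = s at h1 ⊢
        push_cast
        linear_combination (s : ℂ) ^ 2 * h2 + (c : ℂ) ^ 2 * h3 + (c * s : ℂ) * h4 +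
          (c * s : ℂ) * h' + (1 / 2) * h1
      · simp only [map_add, map_mul, Complex.conj_ofReal, e0, e1, hc t, hs t]
        generalize Real.cos (t / 2) = c at h1 ⊢
        generalize Real.sin (t / 2) = s at h1 ⊢
        push_cast
        linear_combination (c * s : ℂ) * h2 - (c * s : ℂ) * h3 + (c : ℂ) ^ 2 * h4 -
          (s : ℂ) ^ 2 * h' + (Complex.I * (x.1 1 : ℂ) / 2) * h1
    · have hz := (hdc.mul_const z).sub (hds.mul_const w)
      have hw := (hds.mul_const z).add (hdc.mul_const w)
      refine (hasDerivAt_coherentVec hz hw k).congr_deriv ?_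
      simp only [spinGen, Matrix.smul_mulVec, Matrix.sub_mulVec,
        Pi.smul_apply, Pi.sub_apply, rhoE_mulVec_coherentVec, rhoF_mulVec_coherentVec, smul_eq_mul]
      simp
      ring_nf
      simp
      ring
  | 2 =>
  · refine ⟨fun t => (Real.cos (t / 2) + Complex.I * Real.sin (t / 2)) * z,
      fun t => (Real.cos (t / 2) - Complex.I * Real.sin (t / 2)) * w, fun t => ?_, fun k => ?_⟩
    · have h1 := hsc t
      have h2 := h.fst
      have h3 := h.snd
      have h4 := h.cross
      have e0 : (rot 2 t x).1 0 = x.1 0 * Real.cos t - x.1 1 * Real.sin t := rfl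
      have e1 : (rot 2 t x).1 1 = x.1 0 * Real.sin t + x.1 1 * Real.cos t := rfl
      have e2 : (rot 2 t x).1 2 = x.1 2 := rfl
      refine ⟨?_, ?_, ?_⟩
      · simp only [map_add, map_mul, Complex.conj_ofReal, Complex.conj_I, e2]
        generalize Real.cos (t / 2) = c at h1 ⊢
        generalize Real.sin (t / 2) = s at h1 ⊢
        linear_combination ((c : ℂ) ^ 2 - Complex.I ^ 2 * (s : ℂ) ^ 2) * h2 -
          ((s : ℂ) ^ 2 * (1 + (x.1 2 : ℂ)) / 2) * hI +
          ((1 + (x.1 2 : ℂ)) / 2) * h1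
      · simp only [map_sub, map_mul, Complex.conj_ofReal, Complex.conj_I, e2]
        generalize Real.cos (t / 2) = c at h1 ⊢
        generalize Real.sin (t / 2) = s at h1 ⊢
        linear_combination ((c : ℂ) ^ 2 - Complex.I ^ 2 * (s : ℂ) ^ 2) * h3 -
          ((s : ℂ) ^ 2 * (1 - (x.1 2 : ℂ)) / 2) * hI +
          ((1 - (x.1 2 : ℂ)) / 2) * h1
      · simp only [map_sub, map_mul, Complex.conj_ofReal, Complex.conj_I, e0, e1, hc t, hs t]
        generalize Real.cos (t / 2) = c at h1 ⊢
        generalize Real.sin (t / 2) = s at h1 ⊢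
        push_cast
        linear_combination (c + Complex.I * s) ^ 2 * h4 +
          (((s : ℂ) ^ 2 * ((x.1 0 : ℂ) + Complex.I * (x.1 1 : ℂ)) + 2 * (c * s : ℂ) *
          (x.1 1 : ℂ)) / 2) * hI
    · have hz := (hdc.add (hds.const_mul Complex.I)).mul_const z
      have hw := (hdc.sub (hds.const_mul Complex.I)).mul_const w
      refine (hasDerivAt_coherentVec hz hw k).congr_deriv ?_
      have hk := Nat.cast_sub (R := ℂ) (Nat.lt_succ_iff.1 k.2)
      have p1 := hpow (N - (k : ℕ)) z
      have p2 := hpow (k : ℕ) w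
      rw [hk] at p1
      simp only [spinGen, rhoH, Matrix.mulVec_diagonal, coherentVec, hk]
      simp
      linear_combination (((Real.sqrt (N.choose (k : ℕ)) : ℝ) : ℂ) * Complex.I / 2) *
        (w ^ (k : ℕ) * p1 - z ^ (N - (k : ℕ)) * p2)

/-- The symbol map intertwines the adjoint action of the spin representation with the angular
momentum operators. -/
theorem angMom_symbol (N : ℕ) (j : Fin 3) (a : FuzzyAlg N) (x : S2) :
    angMom j (symbol N a) x = symbol N (spinGen N j * a - a * spinGen N j) x := by
  obtain ⟨z, w, hzw, hd⟩ := exists_spinor_curve N j x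
  have h0 : IsSpinor (z 0) (w 0) x := by simpa only [rot_zero] using hzw 0
  set ψ : Fin (N + 1) → ℂ := coherentVec N (z 0) (w 0) with hψ
  have h : HasDerivAt (fun t : ℝ => symbol N a (rot j t x))
      (∑ k, (conj (-Complex.I * (spinGen N j *ᵥ ψ) k) * (a *ᵥ ψ) k +
        conj (ψ k) * ∑ l, a k l * (-Complex.I * (spinGen N j *ᵥ ψ) l))) 0 := by
    simp only [symbol_eq_of_isSpinor (hzw _)]
    refine HasDerivAt.fun_sum fun k _ => ?_
    have h1 : HasDerivAt (fun t => ∑ l, a k l * coherentVec N (z t) (w t) l)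
        (∑ l, a k l * (-Complex.I * (spinGen N j *ᵥ ψ) l)) 0 :=
      HasDerivAt.fun_sum fun l _ => (hd l).const_mul (a k l)
    exact ((hd k).star).mul h1
  rw [angMom_eq_of_hasDerivAt h, symbol_eq_of_isSpinor h0, Matrix.sub_mulVec, dotProduct_sub,
    ← Matrix.mulVec_mulVec, ← Matrix.mulVec_mulVec, Matrix.dotProduct_mulVec _ (spinGen N j)]
  have h1 : star ψ ᵥ* spinGen N j = star (spinGen N j *ᵥ ψ) := by
    rw [Matrix.star_mulVec, spinGen_isHermitian]
  have h2 : (∑ k, (conj (-Complex.I * (spinGen N j *ᵥ ψ) k) * (a *ᵥ ψ) k +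
        conj (ψ k) * ∑ l, a k l * (-Complex.I * (spinGen N j *ᵥ ψ) l))) =
      Complex.I * (star (spinGen N j *ᵥ ψ) ⬝ᵥ (a *ᵥ ψ) - star ψ ⬝ᵥ (a *ᵥ (spinGen N j *ᵥ ψ))) := by
    simp only [dotProduct, ← Finset.sum_sub_distrib, Finset.mul_sum (s := Finset.univ)
      (a := Complex.I)]
    refine Finset.sum_congr rfl fun k _ => ?_
    have h3 : ∑ l, a k l * (-Complex.I * (spinGen N j *ᵥ ψ) l) =
        -Complex.I * (a *ᵥ (spinGen N j *ᵥ ψ)) k := by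
      rw [Matrix.mulVec, dotProduct, Finset.mul_sum]
      exact Finset.sum_congr rfl fun l _ => by ring
    rw [h3]
    simp only [map_mul, map_neg, Complex.conj_I, Pi.star_apply, Complex.star_def]
    ring
  rw [← hψ, h1, h2, ← mul_assoc]
  simp

/-! ### Quantization -/

theorem quantize_star (N : ℕ) (f : smoothAlg) : quantize N (star f) = (quantize N f)ᴴ := by
  ext k j
  have hN : star ((N : ℂ) + 1) = (N : ℂ) + 1 := by simp
  simp only [quantize, LinearMap.coe_mk, AddHom.coe_mk, Matrix.of_apply,
    Matrix.conjTranspose_apply, star_mul', hN]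
  rw [Complex.star_def, ← integral_conj]
  congr 1
  refine integral_congr_ae (Filter.Eventually.of_forall fun x => ?_)
  have hq : conj (coherentProj N x j k) = coherentProj N x k j :=
    congrFun (congrFun (coherentProj_conjTranspose N x) k) j
  simp only [map_mul, hq]
  rfl

theorem quantize_sub (N : ℕ) (f g : smoothAlg) :
    quantize N (f - g) = quantize N f - quantize N g := by
  have h : f - g = f + (-1 : ℂ) • g := by
    ext x
    change f.1 x - g.1 x = f.1 x + (-1 : ℂ) * g.1 x
    ring
  rw [h, map_add, map_smul, neg_one_smul, sub_eq_add_neg]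

theorem quantize_neg (N : ℕ) (f : smoothAlg) : quantize N (-f) = -quantize N f := by
  have h : -f = (-1 : ℂ) • f := by
    ext x
    change -f.1 x = (-1 : ℂ) * f.1 x
    ring
  rw [h, map_smul, neg_one_smul]

/-- Quantization is the transpose of the symbol map for the trace pairing. -/
theorem trace_quantize_mul (N : ℕ) (f : smoothAlg) (a : FuzzyAlg N) :
    (quantize N f * a).trace = ((N : ℂ) + 1) * ∫ x, f.1 x * symbol N a x ∂sphereMeasure := by
  have hN : ((N : ℂ) + 1) ≠ 0 := by exact_mod_cast N.succ_ne_zero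
  have h := inner_quantize N (star f) a
  rw [quantize_star, Matrix.conjTranspose_conjTranspose] at h
  have h2 (x : S2) : star ((star f).1 x) = f.1 x := star_star (f.1 x)
  simp only [h2] at h
  rw [h, mul_inv_cancel_left₀ hN]

/-- Equivariance of quantization, dual to that of the symbol map by integration by parts. -/
theorem quantize_angMom (N : ℕ) (j : Fin 3) (f : smoothAlg) :
    quantize N (angMomAlg j f) = spinGen N j * quantize N f - quantize N f * spinGen N j := by
  rw [Matrix.ext_iff_trace_mul_right]
  intro a
  rw [trace_quantize_mul]
  have h := integral_angMom_mul j f (symbolAlg N a)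
  have h1 (x : S2) : angMom j (symbolAlg N a).1 x =
    symbol N (spinGen N j * a - a * spinGen N j) x := angMom_symbol N j a x
  simp only [h1] at h
  refine (congrArg _ h).trans ?_
  rw [mul_neg, ← trace_quantize_mul, Matrix.mul_sub, Matrix.sub_mul, Matrix.trace_sub,
    Matrix.trace_sub, neg_sub, ← Matrix.mul_assoc, ← Matrix.mul_assoc,
    Matrix.trace_mul_comm (quantize N f * a), Matrix.mul_assoc (spinGen N j)]

/-- Schur's lemma for the spin `ℓ` representation. -/
theorem exists_eq_smul_one_of_commute {N : ℕ} {a : FuzzyAlg N}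
    (h : ∀ j, spinGen N j * a = a * spinGen N j) : ∃ c : ℂ, a = c • 1 := by
  -- `ρ(H)` has simple spectrum, so `a` is diagonal; `ρ(E)` links consecutive weights.
  have hH : rhoH N * a = a * rhoH N := h 2
  have hE : rhoE N * a = a * rhoE N := by
    have hE' : rhoE N = -spinGen N 0 - Complex.I • spinGen N 1 := by
      simp only [spinGen, smul_smul, ← mul_div_assoc, Complex.I_mul_I]
      module
    rw [hE', Matrix.sub_mul, Matrix.mul_sub, Matrix.neg_mul, Matrix.mul_neg, Matrix.smul_mul,
      Matrix.mul_smul, h 0, h 1]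
  have hoff (i k : Fin (N + 1)) (hik : i ≠ k) : a i k = 0 := by
    have h1 := congrFun (congrFun hH i) k
    simp only [rhoH, Matrix.diagonal_mul, Matrix.mul_diagonal] at h1
    have h2 : (((i : ℕ) : ℂ) - ((k : ℕ) : ℂ)) * a i k = 0 := by linear_combination h1
    refine (mul_eq_zero.1 h2).resolve_left (sub_ne_zero.2 fun h3 => hik (Fin.ext ?_))
    exact_mod_cast h3
  have hdiag (m : ℕ) (hm : m < N + 1) : a ⟨m, hm⟩ ⟨m, hm⟩ = a 0 0 := by
    induction m with
    | zero => rfl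
    | succ m ih =>
      rw [← ih (by omega)]
      have h1 := congrFun (congrFun hE ⟨m + 1, hm⟩) ⟨m, by omega⟩
      rw [Matrix.mul_apply, Matrix.mul_apply, Finset.sum_eq_single ⟨m, by omega⟩
        (fun b _ hb => by rw [hoff _ _ hb, mul_zero]) (fun h => absurd (Finset.mem_univ _) h),
        Finset.sum_eq_single ⟨m + 1, hm⟩
        (fun b _ hb => by rw [hoff _ _ hb.symm, zero_mul])
        (fun h => absurd (Finset.mem_univ _) h)] at h1
      have h2 : rhoE N ⟨m + 1, hm⟩ ⟨m, by omega⟩ ≠ 0 := by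
        simp only [rhoE, Matrix.of_apply, if_true]
        have hmN : (0 : ℝ) < (N : ℝ) - m := sub_pos.2 (by exact_mod_cast (by omega : m < N))
        exact Complex.ofReal_ne_zero.2 (Real.sqrt_pos.2 (by positivity)).ne'
      rw [mul_comm] at h1
      exact (mul_right_cancel₀ h2 h1).symm
  refine ⟨a 0 0, ?_⟩
  ext i k
  rcases eq_or_ne i k with rfl | hik
  · simpa using hdiag i i.2
  · simp [hoff i k hik, hik]

theorem symbol_one (N : ℕ) (x : S2) : symbol N 1 x = 1 := by
  have h := (add_pow ((1 - (x.1 2 : ℂ)) / 2) ((1 + (x.1 2 : ℂ)) / 2) N).symm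
  rw [show (1 - (x.1 2 : ℂ)) / 2 + (1 + (x.1 2 : ℂ)) / 2 = 1 by ring, one_pow,
    Finset.sum_range] at h
  rw [symbol, Matrix.mul_one, Matrix.trace, ← h]
  refine Finset.sum_congr rfl fun k _ => ?_
  rw [Matrix.diag, coherentProj_eq_poly, coherentPoly, Real.mul_self_sqrt (by positivity)]
  simp
  ring

theorem angMom_one (j : Fin 3) (x : S2) : angMom j (1 : smoothAlg).1 x = 0 := by
  have h : (fun t : ℝ => (1 : smoothAlg).1 (rot j t x)) = fun _ => (1 : ℂ) := rfl
  rw [angMom, h, deriv_const, mul_zero]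

/-- The resolution of the identity by coherent states. The operator `π(1)` commutes with the spin
representation, so it is scalar, and `Tr Q_x = 1` fixes the scalar. -/
theorem quantize_one (N : ℕ) : quantize N 1 = 1 := by
  obtain ⟨c, hc⟩ : ∃ c : ℂ, quantize N 1 = c • 1 := by
    refine exists_eq_smul_one_of_commute fun j => ?_
    rw [← sub_eq_zero, ← quantize_angMom]
    have h : angMomAlg j 1 = 0 := by
      ext x
      exact angMom_one j x
    rw [h, map_zero]
  have h := trace_quantize_mul N 1 1
  have h1 (x : S2) : (1 : smoothAlg).1 x * symbol N 1 x = 1 := by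
    rw [symbol_one]
    exact one_mul 1
  simp only [h1] at h
  rw [hc, Matrix.mul_one, Matrix.trace_smul, Matrix.trace_one] at h
  have hN : ((N : ℂ) + 1) ≠ 0 := by exact_mod_cast N.succ_ne_zero
  have h2 : c = 1 := by
    simp at h
    exact mul_right_cancel₀ hN (by rw [h, one_mul])
  rw [hc, h2, one_smul]

theorem integral_symbol (N : ℕ) (a : FuzzyAlg N) :
    ((N : ℂ) + 1) * ∫ x, symbol N a x ∂sphereMeasure = a.trace := by
  have h := trace_quantize_mul N 1 a
  rw [quantize_one, Matrix.one_mul] at h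
  rw [h]
  congr 2
  funext x
  exact (one_mul _).symm

/-! ### Injectivity of the symbol map -/

/-- A polynomial in `conj ζ` and `ζ` that vanishes identically has vanishing coefficients. -/
theorem eq_zero_of_sum_conj_pow_mul_pow {n : ℕ} (b : Fin n → Fin n → ℂ)
    (h : ∀ ζ : ℂ, ∑ k, ∑ j, b k j * (conj ζ ^ (k : ℕ) * ζ ^ (j : ℕ)) = 0) : b = 0 := by
  have hpoly (P : Polynomial ℂ) (hP : ∀ r : ℝ, P.eval (r : ℂ) = 0) (u : ℂ) : P.eval u = 0 := by
    have : P = 0 := by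
      refine Polynomial.eq_zero_of_infinite_isRoot P
        (Set.Infinite.mono ?_ (Set.infinite_range_of_injective Complex.ofReal_injective))
      rintro _ ⟨r, rfl⟩
      exact hP r
    rw [this, Polynomial.eval_zero]
  -- With `ζ = p + i q` the sum is a polynomial in `(p, q)`, and it vanishes for real `p`, `q`.
  have h1 (q : ℝ) (p : ℂ) : ∑ k, ∑ j, b k j *
      ((p - Complex.I * q) ^ (k : ℕ) * (p + Complex.I * q) ^ (j : ℕ)) = 0 := by
    have := hpoly (∑ k, ∑ j, Polynomial.C (b k j) *
      ((Polynomial.X - Polynomial.C (Complex.I * q)) ^ (k : ℕ) *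
        (Polynomial.X + Polynomial.C (Complex.I * q)) ^ (j : ℕ))) (fun p => by
        have := h ((p : ℂ) + Complex.I * q)
        simp only [map_add, map_mul, Complex.conj_ofReal, Complex.conj_I, neg_mul,
          ← sub_eq_add_neg] at this
        simpa [Polynomial.eval_finsetSum] using this) p
    simpa [Polynomial.eval_finsetSum] using this
  have h2 (p q : ℂ) : ∑ k, ∑ j, b k j *
      ((p - Complex.I * q) ^ (k : ℕ) * (p + Complex.I * q) ^ (j : ℕ)) = 0 := by
    have := hpoly (∑ k, ∑ j, Polynomial.C (b k j) *
      ((Polynomial.C p - Polynomial.C Complex.I * Polynomial.X) ^ (k : ℕ) *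
        (Polynomial.C p + Polynomial.C Complex.I * Polynomial.X) ^ (j : ℕ))) (fun q => by
        simpa [Polynomial.eval_finsetSum] using h1 q p) q
    simpa [Polynomial.eval_finsetSum] using this
  have h3 (s t : ℂ) : ∑ k, s ^ ((k : Fin n) : ℕ) * ∑ j, t ^ ((j : Fin n) : ℕ) * b k j = 0 := by
    rw [← h2 ((s + t) / 2) (Complex.I * (s - t) / 2)]
    have e1 : (s + t) / 2 - Complex.I * (Complex.I * (s - t) / 2) = s := by
      linear_combination (-(s - t) / 2) * Complex.I_mul_I
    have e2 : (s + t) / 2 + Complex.I * (Complex.I * (s - t) / 2) = t := by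
      linear_combination ((s - t) / 2) * Complex.I_mul_I
    rw [e1, e2]
    simp only [Finset.mul_sum]
    exact Finset.sum_congr rfl fun k _ => Finset.sum_congr rfl fun j _ => by ring
  have hinj : Function.Injective fun i : Fin n => ((i : ℕ) : ℂ) := fun i j hij =>
    Fin.ext (Nat.cast_injective hij)
  have h4 (t : ℂ) (k : Fin n) : ∑ j, t ^ ((j : Fin n) : ℕ) * b k j = 0 :=
    congrFun (Matrix.eq_zero_of_forall_index_sum_pow_mul_eq_zero hinj fun i => h3 _ t) k
  funext k
  exact Matrix.eq_zero_of_forall_index_sum_pow_mul_eq_zero hinj fun i => h4 _ k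

/-- Every unit spinor lies over a point of the sphere. -/
theorem exists_isSpinor {z w : ℂ} (h : z * conj z + w * conj w = 1) : ∃ x, IsSpinor z w x := by
  have h' : z.re ^ 2 + z.im ^ 2 + (w.re ^ 2 + w.im ^ 2) = 1 := by
    have := congrArg Complex.re h
    simp at this
    linarith
  refine ⟨⟨!₂[2 * (z * conj w).re, 2 * (z * conj w).im, 2 * (z * conj z).re - 1], ?_⟩, ?_, ?_, ?_⟩
  · rw [mem_sphere_zero_iff_norm, EuclideanSpace.norm_eq, Real.sqrt_eq_one, Fin.sum_univ_three]
    simp only [Real.norm_eq_abs, sq_abs]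
    simp
    have h5 : w.re ^ 2 + w.im ^ 2 = 1 - (z.re ^ 2 + z.im ^ 2) := by linarith
    linear_combination (4 * (z.re ^ 2 + z.im ^ 2)) * h5
  · apply Complex.ext <;> simp
    ring
  · apply Complex.ext <;> simp
    · linarith
    · ring
  · apply Complex.ext <;> simp

/-- The symbol of `a` at the point below the spinor proportional to `(1, ζ)` is, up to a nonzero
factor, a polynomial in `conj ζ` and `ζ` whose coefficients are nonzero multiples of the entries
of `a`. -/
theorem symbol_injective {N : ℕ} {a : FuzzyAlg N} (h : ∀ x, symbol N a x = 0) : a = 0 := by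
  have hb := eq_zero_of_sum_conj_pow_mul_pow (n := N + 1) (fun k j =>
    ((Real.sqrt (N.choose (k : ℕ)) : ℝ) : ℂ) * ((Real.sqrt (N.choose (j : ℕ)) : ℝ) : ℂ) * a k j)
    fun ζ => by
      have hs : (0 : ℝ) < 1 + ‖ζ‖ ^ 2 := by positivity
      set s : ℝ := (Real.sqrt (1 + ‖ζ‖ ^ 2))⁻¹ with hsdef
      have hs0 : (s : ℂ) ≠ 0 := by
        rw [hsdef]
        exact Complex.ofReal_ne_zero.2 (inv_ne_zero (Real.sqrt_pos.2 hs).ne')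
      have hs2 : (s : ℂ) ^ 2 * (1 + ζ * conj ζ) = 1 := by
        rw [Complex.mul_conj, Complex.normSq_eq_norm_sq, hsdef]
        have : ((Real.sqrt (1 + ‖ζ‖ ^ 2))⁻¹) ^ 2 * (1 + ‖ζ‖ ^ 2) = 1 := by
          rw [inv_pow, Real.sq_sqrt hs.le, inv_mul_cancel₀ hs.ne']
        exact_mod_cast this
      obtain ⟨x, hx⟩ := exists_isSpinor (z := (s : ℂ)) (w := s * ζ) (by
        rw [map_mul, Complex.conj_ofReal]
        linear_combination hs2)
      have h1 := h x
      rw [symbol_eq_of_isSpinor hx] at h1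
      refine (mul_eq_zero.1 (?_ : ((s : ℂ) ^ N * (s : ℂ) ^ N) * _ = 0)).resolve_left
        (mul_ne_zero (pow_ne_zero _ hs0) (pow_ne_zero _ hs0))
      rw [← h1]
      simp only [dotProduct, Matrix.mulVec, Finset.mul_sum]
      refine Finset.sum_congr rfl fun k _ => Finset.sum_congr rfl fun j _ => ?_
      have hk : (s : ℂ) ^ N = (s : ℂ) ^ (N - (k : ℕ)) * (s : ℂ) ^ (k : ℕ) := by
        rw [← pow_add, Nat.sub_add_cancel (Nat.lt_succ_iff.1 k.2)]
      have hj : (s : ℂ) ^ N = (s : ℂ) ^ (N - (j : ℕ)) * (s : ℂ) ^ (j : ℕ) := by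
        rw [← pow_add, Nat.sub_add_cancel (Nat.lt_succ_iff.1 j.2)]
      simp only [Pi.star_apply, Complex.star_def, coherentVec, map_mul, map_pow,
        Complex.conj_ofReal, mul_pow]
      nth_rewrite 1 [hk]
      rw [hj]
      ring
  ext k j
  have h1 := congrFun (congrFun hb k) j
  have hpos (i : Fin (N + 1)) : ((Real.sqrt (N.choose (i : ℕ)) : ℝ) : ℂ) ≠ 0 :=
    Complex.ofReal_ne_zero.2 (Real.sqrt_pos.2
      (by exact_mod_cast Nat.choose_pos (Nat.lt_succ_iff.1 i.2))).ne'
  exact (mul_eq_zero.1 h1).resolve_left (mul_ne_zero (hpos k) (hpos j))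

theorem eq_zero_of_integral_eq_zero {g : S2 → ℝ} (hg : Continuous g) (h0 : ∀ x, 0 ≤ g x)
    (h : ∫ x, g x ∂sphereMeasure = 0) (x : S2) : g x = 0 := by
  have h1 := (integral_eq_zero_iff_of_nonneg h0 (integrable_of_continuous hg)).1 h
  exact congrFun ((Continuous.ae_eq_iff_eq sphereMeasure hg continuous_const).1 h1) x

/-- `π ∘ σ` is positive definite for the trace inner product, hence bijective. -/
theorem quantize_symbolAlg_bijective (N : ℕ) :
    Function.Bijective (quantize N ∘ₗ symbolAlg N) := by
  have hinj : Function.Injective (quantize N ∘ₗ symbolAlg N) := by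
    rw [← LinearMap.ker_eq_bot, LinearMap.ker_eq_bot']
    intro a ha
    have h := inner_quantize N (symbolAlg N a) a
    have ha' : quantize N (symbolAlg N a) = 0 := ha
    rw [ha', Matrix.conjTranspose_zero, Matrix.zero_mul, Matrix.trace_zero, mul_zero] at h
    have h1 (x : S2) : star ((symbolAlg N a).1 x) * symbol N a x =
        ((‖symbol N a x‖ ^ 2 : ℝ) : ℂ) := by
      rw [← Complex.normSq_eq_norm_sq, ← Complex.mul_conj, mul_comm]
      rfl
    simp only [h1] at h
    rw [integral_complex_ofReal, Complex.ofReal_eq_zero] at h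
    refine symbol_injective fun x => ?_
    have := eq_zero_of_integral_eq_zero ((symbolAlg N a).1.continuous.norm.pow 2)
      (fun _ => sq_nonneg _) h x
    exact norm_eq_zero.1 (pow_eq_zero_iff two_ne_zero |>.1 this)
  exact ⟨hinj, LinearMap.injective_iff_surjective.1 hinj⟩

/-! ### The commutator with the Dirac operator -/

/-- The matrix of first derivatives of `f` by which `[D, f]` multiplies a spinor. -/
def gradMul (f : S2 → ℂ) (x : S2) (u : Fin 2 → ℂ) : Fin 2 → ℂ :=
  ![partialH f x * u 0 + partialF f x * u 1, partialE f x * u 0 - partialH f x * u 1]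

theorem diracComm_eq_gradMul (f : smoothAlg) (ξ : Fin 2 → smoothAlg) (i : Fin 2) (x : S2) :
    diracComm f.1 (fun i x => (ξ i).1 x) i x = gradMul f.1 x (fun i => (ξ i).1 x) i := by
  have h (j : Fin 3) (k : Fin 2) : angMom j (fun y => f.1 y * (ξ k).1 y) x =
    angMom j f.1 x * (ξ k).1 x + f.1 x * angMom j (ξ k).1 x := angMom_mul j f (ξ k) x
  fin_cases i <;> simp [diracComm, dirac, gradMul, partialH, partialE, partialF, h] <;> ring

theorem continuous_gradMul (f : smoothAlg) {u : S2 → Fin 2 → ℂ} (hu : Continuous u) (i : Fin 2) :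
    Continuous fun x => gradMul f.1 x (u x) i := by
  have h (j : Fin 3) := continuous_angMom j f
  have h0 := h 0
  have h1 := h 1
  have h2 := h 2
  fin_cases i <;> simp only [gradMul, partialH, partialE, partialF] <;> simp <;> fun_prop

/-- The squared Hermitian norm on `ℂ²`. -/
def normSq2 (u : Fin 2 → ℂ) : ℝ := ‖u 0‖ ^ 2 + ‖u 1‖ ^ 2

theorem normSq2_nonneg (u : Fin 2 → ℂ) : 0 ≤ normSq2 u := by
  unfold normSq2
  positivity

theorem normSq2_smul (c : ℂ) (u : Fin 2 → ℂ) :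
    normSq2 (fun i => c * u i) = ‖c‖ ^ 2 * normSq2 u := by
  simp only [normSq2, norm_mul]
  ring

theorem gradMul_smul (f : S2 → ℂ) (x : S2) (c : ℂ) (u : Fin 2 → ℂ) :
    gradMul f x (fun i => c * u i) = fun i => c * gradMul f x u i := by
  funext i
  fin_cases i <;> simp [gradMul] <;> ring

theorem spinorNorm_le_one_iff {ξ : Fin 2 → S2 → ℂ} (hξ : ∀ i, Continuous (ξ i)) :
    spinorNorm ξ ≤ 1 ↔ ∫ x, normSq2 (fun i => ξ i x) ∂sphereMeasure ≤ 1 := by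
  have hc : Continuous fun x =>
      (WithLp.toLp 2 (fun i => ξ i x) : EuclideanSpace ℂ (Fin 2)) :=
    (PiLp.continuous_toLp 2 _).comp (continuous_pi hξ)
  have hm : MemLp (fun x => (WithLp.toLp 2 (fun i => ξ i x) : EuclideanSpace ℂ (Fin 2))) 2
      sphereMeasure := by
    obtain ⟨C, hC⟩ := (isCompact_range hc.norm).bddAbove
    exact MemLp.of_bound hc.aestronglyMeasurable C
      (Filter.Eventually.of_forall fun x => hC ⟨x, rfl⟩)
  have h1 (x : S2) : ‖(WithLp.toLp 2 (fun i => ξ i x) : EuclideanSpace ℂ (Fin 2))‖ ^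
      (ENNReal.toReal 2) = normSq2 (fun i => ξ i x) := by
    rw [ENNReal.toReal_ofNat, Real.rpow_ofNat, EuclideanSpace.norm_sq_eq, Fin.sum_univ_two]
    rfl
  rw [spinorNorm, hm.eLpNorm_eq_integral_rpow_norm two_ne_zero ENNReal.ofNat_ne_top]
  simp only [h1]
  rw [ENNReal.ofReal_le_one]
  have h0 : 0 ≤ ∫ x, normSq2 (fun i => ξ i x) ∂sphereMeasure :=
    integral_nonneg fun x => normSq2_nonneg _
  constructor
  · intro h
    by_contra! hlt
    exact absurd h (not_le.2 (Real.one_lt_rpow hlt (by norm_num)))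
  · intro h
    exact Real.rpow_le_one h0 h (by norm_num)

theorem continuous_normSq2 {u : S2 → Fin 2 → ℂ} (hu : ∀ i, Continuous fun x => u x i) :
    Continuous fun x => normSq2 (u x) :=
  ((hu 0).norm.pow 2).add ((hu 1).norm.pow 2)

/-- A smooth function on the sphere supported near a point. -/
theorem exists_bump {U : Set S2} (hU : IsOpen U) {x₀ : S2} (hx₀ : x₀ ∈ U) :
    ∃ g : smoothAlg, g.1 x₀ = 1 ∧ ∀ x, x ∉ U → g.1 x = 0 := by
  obtain ⟨r, hr, hrU⟩ := Metric.isOpen_iff.1 hU x₀ hx₀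
  let b : ContDiffBump (x₀ : EuclideanSpace ℝ (Fin 3)) := ⟨r / 2, r, half_pos hr, half_lt_self hr⟩
  have hb : ContMDiff (𝓡 2) 𝓘(ℝ, ℂ) ∞ fun x : S2 => ((b x : ℝ) : ℂ) :=
    (Complex.ofRealCLM.contDiff.comp b.contDiff).contMDiff.comp contMDiff_coe_sphere
  refine ⟨⟨⟨_, hb.continuous⟩, hb⟩, ?_, fun x hx => ?_⟩
  · change ((b x₀ : ℝ) : ℂ) = 1
    rw [b.one_of_mem_closedBall (Metric.mem_closedBall_self (half_pos hr).le), Complex.ofReal_one]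
  · change ((b x : ℝ) : ℂ) = 0
    have : r ≤ dist (x : EuclideanSpace ℝ (Fin 3)) x₀ := by
      by_contra! h
      exact hx (hrU h)
    rw [b.zero_of_le_dist this, Complex.ofReal_zero]

/-- The operator norm of `[D, f]` is the supremum of the pointwise operator norms. -/
theorem diracSeminorm_le_one_iff (f : smoothAlg) :
    diracSeminorm f.1 ≤ 1 ↔ ∀ x u, normSq2 (gradMul f.1 x u) ≤ normSq2 u := by
  have hcont (ξ : Fin 2 → smoothAlg) : Continuous fun x : S2 => fun i => (ξ i).1 x :=
    continuous_pi fun i => (ξ i).1.continuous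
  have hcomm (ξ : Fin 2 → smoothAlg) :
      spinorNorm (diracComm f.1 fun i x => (ξ i).1 x) ≤ 1 ↔
        ∫ x, normSq2 (gradMul f.1 x fun i => (ξ i).1 x) ∂sphereMeasure ≤ 1 := by
    have h : diracComm f.1 (fun i x => (ξ i).1 x) =
        fun i x => gradMul f.1 x (fun i => (ξ i).1 x) i := by
      funext i x
      exact diracComm_eq_gradMul f ξ i x
    rw [h, spinorNorm_le_one_iff fun i => continuous_gradMul f (hcont ξ) i]
  have hL : diracSeminorm f.1 ≤ 1 ↔ ∀ ξ : Fin 2 → smoothAlg,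
      ∫ x, normSq2 (fun i => (ξ i).1 x) ∂sphereMeasure ≤ 1 →
        ∫ x, normSq2 (gradMul f.1 x fun i => (ξ i).1 x) ∂sphereMeasure ≤ 1 := by
    rw [diracSeminorm, iSup₂_le_iff]
    refine forall_congr' fun ξ => ?_
    rw [spinorNorm_le_one_iff fun i => (ξ i).1.continuous, hcomm]
  rw [hL]
  constructor
  · intro h x₀ u
    by_contra! hlt
    -- `‖M(x) u‖ > ‖u‖` persists on a neighbourhood; test on a spinor `g u` supported there.
    have hM : Continuous fun x => normSq2 (gradMul f.1 x u) :=
      continuous_normSq2 fun i => continuous_gradMul f continuous_const i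
    obtain ⟨g, hg1, hg0⟩ := exists_bump
      (isOpen_lt (continuous_const (y := normSq2 u)) hM) (x₀ := x₀) hlt
    have hgc : Continuous fun x => ‖g.1 x‖ ^ 2 := g.1.continuous.norm.pow 2
    obtain ⟨I, hI⟩ : ∃ I, I = ∫ x, ‖g.1 x‖ ^ 2 * normSq2 u ∂sphereMeasure := ⟨_, rfl⟩
    obtain ⟨J, hJ⟩ : ∃ J, J = ∫ x, ‖g.1 x‖ ^ 2 * normSq2 (gradMul f.1 x u) ∂sphereMeasure :=
      ⟨_, rfl⟩
    have hI0 : 0 ≤ I := hI ▸ integral_nonneg fun x => mul_nonneg (sq_nonneg _) (normSq2_nonneg _)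
    have hJ0 : 0 ≤ J := hJ ▸ integral_nonneg fun x => mul_nonneg (sq_nonneg _) (normSq2_nonneg _)
    have hscale (c : ℝ) (hc : c ^ 2 * I ≤ 1) : c ^ 2 * J ≤ 1 := by
      have h1 := h fun i => ((c : ℂ) * u i) • g
      have e1 (x : S2) : (fun i => (((c : ℂ) * u i) • g).1 x) =
          fun i => ((c : ℂ) * g.1 x) * u i := by
        funext i
        change ((c : ℂ) * u i) * g.1 x = _
        ring
      have e2 (x : S2) : ‖(c : ℂ) * g.1 x‖ ^ 2 = c ^ 2 * ‖g.1 x‖ ^ 2 := by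
        rw [norm_mul, mul_pow, Complex.norm_real, Real.norm_eq_abs, sq_abs]
      simp only [e1, gradMul_smul, normSq2_smul, e2] at h1
      simp only [mul_assoc, integral_const_mul, ← hI, ← hJ] at h1
      exact h1 hc
    -- Scaling by `2 / (I + J)` also covers the case `I = 0`.
    have hJI : J ≤ I := by
      by_contra! hIJ
      have hpos : 0 < I + J := by linarith
      have h2 := hscale (Real.sqrt (2 / (I + J))) (by
        rw [Real.sq_sqrt (div_nonneg zero_le_two hpos.le), div_mul_eq_mul_div, div_le_one hpos]
        linarith)
      rw [Real.sq_sqrt (div_nonneg zero_le_two hpos.le), div_mul_eq_mul_div, div_le_one hpos] at h2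
      linarith
    have hdiff : ∫ x, ‖g.1 x‖ ^ 2 * (normSq2 (gradMul f.1 x u) - normSq2 u) ∂sphereMeasure =
        J - I := by
      simp only [mul_sub, hI, hJ]
      exact integral_sub (integrable_of_continuous (hgc.mul hM))
        (integrable_of_continuous (hgc.mul continuous_const))
    have hnn (x : S2) : 0 ≤ ‖g.1 x‖ ^ 2 * (normSq2 (gradMul f.1 x u) - normSq2 u) := by
      by_cases hx : normSq2 u < normSq2 (gradMul f.1 x u)
      · exact mul_nonneg (sq_nonneg _) (sub_nonneg.2 hx.le)
      · rw [hg0 x hx]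
        simp
    have h0 := eq_zero_of_integral_eq_zero
      (g := fun x => ‖g.1 x‖ ^ 2 * (normSq2 (gradMul f.1 x u) - normSq2 u))
      (hgc.mul (hM.sub continuous_const)) hnn
      (le_antisymm (by rw [hdiff]; linarith) (integral_nonneg hnn)) x₀
    simp only [hg1, norm_one, one_pow, one_mul] at h0
    linarith
  · intro h ξ hξ
    refine le_trans (integral_mono
      (integrable_of_continuous (continuous_normSq2 fun i => continuous_gradMul f (hcont ξ) i))
      (integrable_of_continuous (continuous_normSq2 fun i => (ξ i).1.continuous))
      fun x => h x _) hξ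

/-! ### The commutator with the truncated Dirac operator -/

/-- The commutator `[X, a]`. -/
def comm {N : ℕ} (X a : FuzzyAlg N) : FuzzyAlg N := X * a - a * X

theorem fuzzyDirac_commutator (N : ℕ) (a : FuzzyAlg N) :
    fuzzyDirac N * amplify N a - amplify N a * fuzzyDirac N =
      Matrix.fromBlocks (comm (rhoH N) a) (comm (rhoF N) a) (comm (rhoE N) a)
        (-comm (rhoH N) a) := by
  simp only [fuzzyDirac, amplify, Matrix.fromBlocks_multiply, Matrix.mul_zero, Matrix.zero_mul,
    add_zero, zero_add, sub_eq_add_neg, Matrix.fromBlocks_neg, Matrix.fromBlocks_add, comm]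
  congr 1 <;> noncomm_ring

theorem rhoE_eq (N : ℕ) : rhoE N = -(spinGen N 0 + Complex.I • spinGen N 1) := by
  simp only [spinGen, smul_smul, ← mul_div_assoc, Complex.I_mul_I]
  module

theorem rhoF_eq (N : ℕ) : rhoF N = -(spinGen N 0 - Complex.I • spinGen N 1) := by
  simp only [spinGen, smul_smul, ← mul_div_assoc, Complex.I_mul_I]
  module

theorem comm_rhoE (N : ℕ) (a : FuzzyAlg N) :
    comm (rhoE N) a = -(comm (spinGen N 0) a + Complex.I • comm (spinGen N 1) a) := by
  rw [rhoE_eq]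
  simp only [comm, Matrix.neg_mul, Matrix.mul_neg, Matrix.add_mul, Matrix.mul_add,
    Matrix.smul_mul, Matrix.mul_smul]
  module

theorem comm_rhoF (N : ℕ) (a : FuzzyAlg N) :
    comm (rhoF N) a = -(comm (spinGen N 0) a - Complex.I • comm (spinGen N 1) a) := by
  rw [rhoF_eq]
  simp only [comm, Matrix.neg_mul, Matrix.mul_neg, Matrix.sub_mul, Matrix.mul_sub,
    Matrix.smul_mul, Matrix.mul_smul]
  module

theorem symbol_neg (N : ℕ) (a : FuzzyAlg N) (x : S2) : symbol N (-a) x = -symbol N a x := by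
  rw [symbol, Matrix.mul_neg, Matrix.trace_neg, symbol]

theorem partialH_symbol (N : ℕ) (a : FuzzyAlg N) (x : S2) :
    partialH (symbol N a) x = symbol N (comm (rhoH N) a) x :=
  angMom_symbol N 2 a x

/-- The sign reflects that the symbol of `ρ(H)` is `-ℓ cos ϑ`; the automorphism
`E ↦ -E`, `F ↦ -F`, `H ↦ H` is implemented by `diag (1, -1)` on `ℂ²`. -/
theorem partialE_symbol (N : ℕ) (a : FuzzyAlg N) (x : S2) :
    partialE (symbol N a) x = -symbol N (comm (rhoE N) a) x := by
  rw [partialE, angMom_symbol, angMom_symbol, comm_rhoE, symbol_neg, symbol_add, symbol_smul,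
    neg_neg]
  rfl

theorem partialF_symbol (N : ℕ) (a : FuzzyAlg N) (x : S2) :
    partialF (symbol N a) x = -symbol N (comm (rhoF N) a) x := by
  rw [partialF, angMom_symbol, angMom_symbol, comm_rhoF, symbol_neg, neg_neg,
    symbol_sub N (comm _ a), symbol_smul]
  rfl

theorem fuzzySeminorm_le_one_iff (N : ℕ) (a : FuzzyAlg N) :
    fuzzySeminorm N a ≤ 1 ↔ ∀ v : Fin (N + 1) ⊕ Fin (N + 1) → ℂ,
      ∑ i, ‖((fuzzyDirac N * amplify N a - amplify N a * fuzzyDirac N) *ᵥ v) i‖ ^ 2 ≤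
        ∑ i, ‖v i‖ ^ 2 := by
  rw [fuzzySeminorm, ← ofReal_norm, ENNReal.ofReal_le_one,
    ContinuousLinearMap.opNorm_le_iff zero_le_one]
  constructor
  · intro h v
    have h1 := h (WithLp.toLp 2 v)
    rw [one_mul] at h1
    have h2 := pow_le_pow_left₀ (norm_nonneg _) h1 2
    rw [EuclideanSpace.norm_sq_eq, EuclideanSpace.norm_sq_eq] at h2
    exact h2
  · intro h v
    rw [one_mul]
    refine le_of_sq_le_sq ?_ (norm_nonneg _)
    rw [EuclideanSpace.norm_sq_eq, EuclideanSpace.norm_sq_eq]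
    exact h v.ofLp

/-! ### Contractivity of the symbol and quantization maps -/

/-- The unit coherent vector at `x` with the phase fixed by the spherical coordinates of `x`. -/
def polarVec (N : ℕ) (x : S2) : Fin (N + 1) → ℂ :=
  coherentVec N (Real.cos (polar x / 2) : ℂ)
    ((Real.sin (polar x / 2) : ℂ) * Complex.exp (-(Complex.I * (azimuth x : ℂ))))

theorem symbol_eq_polarVec (N : ℕ) (a : FuzzyAlg N) (x : S2) :
    symbol N a x = star (polarVec N x) ⬝ᵥ (a *ᵥ polarVec N x) :=
  symbol_eq_of_isSpinor (isSpinor_polar x) a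

theorem star_dotProduct_self {n : Type*} [Fintype n] (v : n → ℂ) :
    star v ⬝ᵥ v = ((∑ i, ‖v i‖ ^ 2 : ℝ) : ℂ) := by
  simp only [dotProduct, Pi.star_apply, Complex.star_def, Complex.conj_mul', Complex.ofReal_sum,
    Complex.ofReal_pow]

theorem sum_norm_sq_polarVec (N : ℕ) (x : S2) : ∑ k, ‖polarVec N x k‖ ^ 2 = 1 := by
  have h := symbol_eq_polarVec N 1 x
  rw [symbol_one, Matrix.one_mulVec, star_dotProduct_self] at h
  exact_mod_cast h.symm

theorem norm_star_polarVec_dotProduct_le (N : ℕ) (x : S2) (y : Fin (N + 1) → ℂ) :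
    ‖star (polarVec N x) ⬝ᵥ y‖ ^ 2 ≤ ∑ k, ‖y k‖ ^ 2 := by
  have h1 : ‖star (polarVec N x) ⬝ᵥ y‖ ≤ ∑ k, ‖polarVec N x k‖ * ‖y k‖ := by
    refine (norm_sum_le _ _).trans (le_of_eq (Finset.sum_congr rfl fun k _ => ?_))
    rw [norm_mul, Pi.star_apply, norm_star]
  have h2 := Finset.sum_mul_sq_le_sq_mul_sq Finset.univ (fun k => ‖polarVec N x k‖)
    (fun k => ‖y k‖)
  rw [sum_norm_sq_polarVec, one_mul] at h2
  exact (pow_le_pow_left₀ (norm_nonneg _) h1 2).trans h2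

/-- The symbol map does not increase the Lipschitz seminorm: the matrix of derivatives of `σ(a)` at
`x` is, up to conjugation by `diag (1, -1)`, the compression of `[D_ℓ, a]` to the coherent vector
at `x`. -/
theorem diracSeminorm_symbol_le_one {N : ℕ} {a : FuzzyAlg N} (h : fuzzySeminorm N a ≤ 1) :
    diracSeminorm (symbol N a) ≤ 1 := by
  rw [fuzzySeminorm_le_one_iff, fuzzyDirac_commutator] at h
  refine (diracSeminorm_le_one_iff (symbolAlg N a)).2 fun x u => ?_
  change normSq2 (gradMul (symbol N a) x u) ≤ normSq2 u
  set ψ := polarVec N x with hψ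
  have h1 := h (Sum.elim (u 0 • ψ) (-u 1 • ψ))
  rw [Matrix.fromBlocks_mulVec, Fintype.sum_sum_type, Fintype.sum_sum_type] at h1
  simp only [Sum.elim_inl, Sum.elim_inr, Sum.elim_comp_inl, Sum.elim_comp_inr, Pi.smul_apply,
    norm_smul, norm_neg, mul_pow, ← Finset.mul_sum] at h1
  rw [hψ, sum_norm_sq_polarVec, mul_one, mul_one, ← hψ] at h1
  refine le_trans ?_ h1
  refine add_le_add (le_trans (le_of_eq ?_) (norm_star_polarVec_dotProduct_le N x _))
    (le_trans (le_of_eq ?_) (norm_star_polarVec_dotProduct_le N x _))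
  · congr 2
    simp only [gradMul, partialH_symbol, partialF_symbol, symbol_eq_polarVec, ← hψ,
      Matrix.cons_val_zero, Matrix.mulVec_smul, dotProduct_add, dotProduct_smul, smul_eq_mul]
    ring
  · rw [← norm_neg]
    congr 2
    simp only [gradMul, partialH_symbol, partialE_symbol, symbol_eq_polarVec, ← hψ,
      Matrix.cons_val_one, Matrix.mulVec_smul, dotProduct_add, dotProduct_smul, smul_eq_mul,
      Matrix.neg_mulVec, dotProduct_neg]
    simp
    ring

theorem symbol_vecMulVec (N : ℕ) (q p : Fin (N + 1) → ℂ) (x : S2) :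
    symbol N (Matrix.vecMulVec q (star p)) x =
      conj (star (polarVec N x) ⬝ᵥ p) * (star (polarVec N x) ⬝ᵥ q) := by
  have h : star p ⬝ᵥ polarVec N x = conj (star (polarVec N x) ⬝ᵥ p) := by
    rw [← Complex.star_def, Matrix.star_dotProduct]
  rw [symbol_eq_polarVec, Matrix.vecMulVec_mulVec, ← h, dotProduct_smul]
  exact mul_comm _ _

theorem star_dotProduct_quantize (N : ℕ) (g : smoothAlg) (p q : Fin (N + 1) → ℂ) :
    star p ⬝ᵥ (quantize N g *ᵥ q) = ((N : ℂ) + 1) * ∫ x, g.1 x *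
      (conj (star (polarVec N x) ⬝ᵥ p) * (star (polarVec N x) ⬝ᵥ q)) ∂sphereMeasure := by
  simp only [← symbol_vecMulVec]
  rw [← trace_quantize_mul, Matrix.mul_vecMulVec, Matrix.trace_vecMulVec, dotProduct_comm]

theorem norm_sq_dotProduct_eq (N : ℕ) (p : Fin (N + 1) → ℂ) (x : S2) :
    ((‖star (polarVec N x) ⬝ᵥ p‖ ^ 2 : ℝ) : ℂ) =
      symbol N (Matrix.vecMulVec p (star p)) x := by
  rw [symbol_vecMulVec, Complex.conj_mul', Complex.ofReal_pow]

theorem continuous_symbol (N : ℕ) (a : FuzzyAlg N) : Continuous (symbol N a) :=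
  (symbolAlg N a).1.continuous

theorem continuous_norm_sq_dotProduct (N : ℕ) (p : Fin (N + 1) → ℂ) :
    Continuous fun x => ‖star (polarVec N x) ⬝ᵥ p‖ ^ 2 := by
  have h : (fun x => ‖star (polarVec N x) ⬝ᵥ p‖ ^ 2) =
      fun x => (symbol N (Matrix.vecMulVec p (star p)) x).re := by
    funext x
    rw [← norm_sq_dotProduct_eq, Complex.ofReal_re]
  rw [h]
  exact Complex.continuous_re.comp (continuous_symbol N _)

theorem integral_norm_sq_dotProduct (N : ℕ) (p : Fin (N + 1) → ℂ) :
    ((N : ℝ) + 1) * ∫ x, ‖star (polarVec N x) ⬝ᵥ p‖ ^ 2 ∂sphereMeasure = ∑ k, ‖p k‖ ^ 2 := by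
  have h := integral_symbol N (Matrix.vecMulVec p (star p))
  simp only [← norm_sq_dotProduct_eq] at h
  rw [integral_complex_ofReal, Matrix.trace_vecMulVec, dotProduct_comm, star_dotProduct_self] at h
  exact_mod_cast h

/-- Quantization does not increase the Lipschitz seminorm: `[D_ℓ, π(f)]` is, up to conjugation by
`diag (1, -1)`, the quantization of the matrix of derivatives of `f`, and quantization of matrix
valued functions is contractive by the resolution of the identity. -/
theorem fuzzySeminorm_quantize_le_one {N : ℕ} {f : smoothAlg} (h : diracSeminorm f.1 ≤ 1) :
    fuzzySeminorm N (quantize N f) ≤ 1 := by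
  rw [diracSeminorm_le_one_iff] at h
  rw [fuzzySeminorm_le_one_iff, fuzzyDirac_commutator]
  have hJ (j : Fin 3) : comm (spinGen N j) (quantize N f) = quantize N (angMomAlg j f) :=
    (quantize_angMom N j f).symm
  obtain ⟨gH, hgH⟩ : ∃ g, g = angMomAlg 2 f := ⟨_, rfl⟩
  obtain ⟨gE, hgE⟩ : ∃ g, g = angMomAlg 0 f + Complex.I • angMomAlg 1 f := ⟨_, rfl⟩
  obtain ⟨gF, hgF⟩ : ∃ g, g = angMomAlg 0 f - Complex.I • angMomAlg 1 f := ⟨_, rfl⟩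
  have eH : comm (rhoH N) (quantize N f) = quantize N gH := hgH ▸ hJ 2
  have eE : comm (rhoE N) (quantize N f) = quantize N (-gE) := by
    rw [comm_rhoE, hJ, hJ, hgE, quantize_neg, map_add, map_smul]
  have eF : comm (rhoF N) (quantize N f) = quantize N (-gF) := by
    rw [comm_rhoF, hJ, hJ, hgF, quantize_neg, quantize_sub, map_smul]
  have hM (x : S2) (u : Fin 2 → ℂ) : gradMul f.1 x u =
      ![gH.1 x * u 0 + gF.1 x * u 1, gE.1 x * u 0 - gH.1 x * u 1] := by
    rw [hgH, hgE, hgF]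
    rfl
  rw [eH, eE, eF, ← quantize_neg]
  set T := Matrix.fromBlocks (quantize N gH) (quantize N (-gF)) (quantize N (-gE))
    (quantize N (-gH)) with hT
  have key (v w : Fin (N + 1) ⊕ Fin (N + 1) → ℂ) :
      ‖star v ⬝ᵥ (T *ᵥ w)‖ ≤ (∑ i, ‖v i‖ ^ 2 + ∑ i, ‖w i‖ ^ 2) / 2 := by
    obtain ⟨c, hc⟩ : ∃ c : (Fin (N + 1) → ℂ) → S2 → ℂ,
      c = fun p x => star (polarVec N x) ⬝ᵥ p := ⟨_, rfl⟩
    have hQ (g : smoothAlg) (p q : Fin (N + 1) → ℂ) : star p ⬝ᵥ (quantize N g *ᵥ q) =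
        ((N : ℂ) + 1) * ∫ x, g.1 x * (conj (c p x) * c q x) ∂sphereMeasure := by
      rw [hc]
      exact star_dotProduct_quantize N g p q
    have hint (g : smoothAlg) (p q : Fin (N + 1) → ℂ) :
        Integrable (fun x => g.1 x * (conj (c p x) * c q x)) sphereMeasure := by
      rw [hc]
      simp only [← symbol_vecMulVec]
      exact integrable_of_continuous (g.1.continuous.mul (continuous_symbol N _))
    have hadd {F G : S2 → ℂ} (hF : Integrable F sphereMeasure) (hG : Integrable G sphereMeasure) :
        Integrable (fun x => F x + G x) sphereMeasure := hF.add hG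
    have hadd' {F G : S2 → ℝ} (hF : Integrable F sphereMeasure)
        (hG : Integrable G sphereMeasure) :
        Integrable (fun x => F x + G x) sphereMeasure := hF.add hG
    have hn (p : Fin (N + 1) → ℂ) : Integrable (fun x => ‖c p x‖ ^ 2) sphereMeasure := by
      rw [hc]
      exact integrable_of_continuous (continuous_norm_sq_dotProduct N p)
    have hni (p : Fin (N + 1) → ℂ) :
        ((N : ℝ) + 1) * ∫ x, ‖c p x‖ ^ 2 ∂sphereMeasure = ∑ k, ‖p k‖ ^ 2 := by
      rw [hc]
      exact integral_norm_sq_dotProduct N p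
    set v₀ := v ∘ Sum.inl
    set v₁ := v ∘ Sum.inr
    set w₀ := w ∘ Sum.inl
    set w₁ := w ∘ Sum.inr
    have hsplit : star v ⬝ᵥ (T *ᵥ w) =
        star v₀ ⬝ᵥ (quantize N gH *ᵥ w₀) + star v₀ ⬝ᵥ (quantize N (-gF) *ᵥ w₁) +
        (star v₁ ⬝ᵥ (quantize N (-gE) *ᵥ w₀) + star v₁ ⬝ᵥ (quantize N (-gH) *ᵥ w₁)) := by
      rw [hT, Matrix.fromBlocks_mulVec, ← dotProduct_add, ← dotProduct_add]
      simp only [dotProduct, Fintype.sum_sum_type]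
      rfl
    have hΦ : star v ⬝ᵥ (T *ᵥ w) = ((N : ℂ) + 1) * ∫ x,
        ((gH.1 x * (conj (c v₀ x) * c w₀ x) + (-gF).1 x * (conj (c v₀ x) * c w₁ x)) +
          ((-gE).1 x * (conj (c v₁ x) * c w₀ x) + (-gH).1 x * (conj (c v₁ x) * c w₁ x)))
          ∂sphereMeasure := by
      rw [hsplit, hQ, hQ, hQ, hQ, integral_add (hadd (hint _ _ _) (hint _ _ _))
        (hadd (hint _ _ _) (hint _ _ _)), integral_add (hint _ _ _) (hint _ _ _),
        integral_add (hint _ _ _) (hint _ _ _)]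
      ring
    have hbound (x : S2) :
        ‖(gH.1 x * (conj (c v₀ x) * c w₀ x) + (-gF).1 x * (conj (c v₀ x) * c w₁ x)) +
          ((-gE).1 x * (conj (c v₁ x) * c w₀ x) + (-gH).1 x * (conj (c v₁ x) * c w₁ x))‖ ≤
        ((‖c v₀ x‖ ^ 2 + ‖c v₁ x‖ ^ 2) + (‖c w₀ x‖ ^ 2 + ‖c w₁ x‖ ^ 2)) / 2 := by
      have hx := h x ![c w₀ x, -c w₁ x]
      rw [hM] at hx
      simp only [normSq2, Matrix.cons_val_zero, Matrix.cons_val_one, norm_neg] at hx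
      set m₀ := gH.1 x * c w₀ x + gF.1 x * -c w₁ x with hm₀
      set m₁ := gE.1 x * c w₀ x - gH.1 x * -c w₁ x with hm₁
      have e : (gH.1 x * (conj (c v₀ x) * c w₀ x) + (-gF).1 x * (conj (c v₀ x) * c w₁ x)) +
          ((-gE).1 x * (conj (c v₁ x) * c w₀ x) + (-gH).1 x * (conj (c v₁ x) * c w₁ x)) =
          conj (c v₀ x) * m₀ - conj (c v₁ x) * m₁ := by
        change (gH.1 x * (conj (c v₀ x) * c w₀ x) + (-gF.1 x) * (conj (c v₀ x) * c w₁ x)) +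
          ((-gE.1 x) * (conj (c v₁ x) * c w₀ x) + (-gH.1 x) * (conj (c v₁ x) * c w₁ x)) = _
        rw [hm₀, hm₁]
        ring
      rw [e]
      have h1 := norm_sub_le (conj (c v₀ x) * m₀) (conj (c v₁ x) * m₁)
      rw [norm_mul, norm_mul, RCLike.norm_conj, RCLike.norm_conj] at h1
      nlinarith [sq_nonneg (‖c v₀ x‖ - ‖m₀‖), sq_nonneg (‖c v₁ x‖ - ‖m₁‖)]
    have hle := norm_integral_le_of_norm_le
      ((hadd' (hadd' (hn v₀) (hn v₁)) (hadd' (hn w₀) (hn w₁))).div_const 2)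
      (Filter.Eventually.of_forall hbound)
    have hN : ‖(N : ℂ) + 1‖ = (N : ℝ) + 1 := by
      have : (N : ℂ) + 1 = (((N : ℝ) + 1 : ℝ) : ℂ) := by push_cast; rfl
      rw [this, Complex.norm_real, Real.norm_of_nonneg (by positivity)]
    rw [hΦ, norm_mul, hN]
    refine (mul_le_mul_of_nonneg_left hle (by positivity)).trans (le_of_eq ?_)
    rw [integral_div, integral_add (hadd' (hn v₀) (hn v₁)) (hadd' (hn w₀) (hn w₁)),
      integral_add (hn v₀) (hn v₁), integral_add (hn w₀) (hn w₁), Fintype.sum_sum_type,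
      Fintype.sum_sum_type]
    have h1 := hni v₀
    have h2 := hni v₁
    have h3 := hni w₀
    have h4 := hni w₁
    simp only [v₀, v₁, w₀, w₁, Function.comp_apply] at h1 h2 h3 h4 ⊢
    linear_combination (h1 + h2 + h3 + h4) / 2
  -- With `v = T w` the bound absorbs half of `‖T w‖²` on the left.
  intro w
  have h1 := key (T *ᵥ w) w
  rw [star_dotProduct_self, Complex.norm_real, Real.norm_of_nonneg (by positivity)] at h1
  linarith

/-! ### The two-sided comparison -/

theorem flatDist_le_fuzzyDist (N : ℕ) (φ ψ : FuzzyAlg N →ₗ[ℂ] ℂ) :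
    flatDist N φ ψ ≤ fuzzyDist N φ ψ := by
  refine iSup₂_le fun f hf => ?_
  have hsa : IsSelfAdjoint (quantize N f) := by
    rw [IsSelfAdjoint, Matrix.star_eq_conjTranspose, ← quantize_star, hf.1.star_eq]
  exact le_iSup₂_of_le (f := fun (a : FuzzyAlg N) (_ : IsSelfAdjoint a ∧ fuzzySeminorm N a ≤ 1) =>
    (((φ a - ψ a).re : ℝ) : EReal)) (quantize N f) ⟨hsa, fuzzySeminorm_quantize_le_one hf.2⟩ le_rfl

/-- Quantization is surjective on self-adjoint elements: the real part of any preimage will do. -/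
theorem exists_isSelfAdjoint_quantize_eq {N : ℕ} {a : FuzzyAlg N} (ha : IsSelfAdjoint a) :
    ∃ f : smoothAlg, IsSelfAdjoint f ∧ quantize N f = a := by
  obtain ⟨b, hb⟩ := (quantize_symbolAlg_bijective N).2 a
  have hb' : quantize N (symbolAlg N b) = a := hb
  refine ⟨(1 / 2 : ℝ) • (symbolAlg N b + star (symbolAlg N b)), ?_, ?_⟩
  · rw [IsSelfAdjoint, star_smul, star_add, star_star, add_comm]
    simp
  · have h : (1 / 2 : ℝ) • (symbolAlg N b + star (symbolAlg N b)) =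
      (1 / 2 : ℂ) • (symbolAlg N b + star (symbolAlg N b)) := by
      ext x
      change ((1 / 2 : ℝ) : ℂ) * _ = (1 / 2 : ℂ) * _
      norm_num
    rw [h, map_smul, map_add, quantize_star, hb', ← Matrix.star_eq_conjTranspose, ha.star_eq,
      ← two_smul ℂ a, smul_smul]
    norm_num

/-- A self-adjoint `a` lifts to a real `f` with `π(f) = a`, and then `B(f) = σ(a)`. -/
theorem fuzzyDist_le_berezinDist (N : ℕ) (φ ψ : FuzzyAlg N →ₗ[ℂ] ℂ) :
    fuzzyDist N φ ψ ≤ berezinDist N (sharp N φ) (sharp N ψ) := by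
  refine iSup₂_le fun a ha => ?_
  obtain ⟨f, hf, rfl⟩ := exists_isSelfAdjoint_quantize_eq ha.1
  exact le_iSup₂_of_le (f := fun (f : smoothAlg)
    (_ : IsSelfAdjoint f ∧ diracSeminorm (berezin N f) ≤ 1) =>
    (((sharp N φ f - sharp N ψ f).re : ℝ) : EReal)) f ⟨hf, diracSeminorm_symbol_le_one ha.2⟩ le_rfl

/-! ### Point evaluations are at infinite Berezin distance -/

/-- The squared chordal distance to `x`, as a smooth function. -/
def distSqAlg (x : S2) : smoothAlg :=
  have h : ContMDiff (𝓡 2) 𝓘(ℝ, ℂ) ∞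
      (fun z : S2 => ((‖(z : EuclideanSpace ℝ (Fin 3)) - x‖ ^ 2 : ℝ) : ℂ)) :=
    (Complex.ofRealCLM.contDiff.comp
      ((contDiff_id.sub contDiff_const).norm_sq ℝ)).contMDiff.comp contMDiff_coe_sphere
  ⟨⟨_, h.continuous⟩, h⟩

theorem distSqAlg_apply (x z : S2) :
    (distSqAlg x).1 z = ((‖(z : EuclideanSpace ℝ (Fin 3)) - x‖ ^ 2 : ℝ) : ℂ) := rfl

theorem distSqAlg_ne_zero {x z : S2} (h : z ≠ x) :
    ‖(z : EuclideanSpace ℝ (Fin 3)) - x‖ ^ 2 ≠ 0 :=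
  pow_ne_zero _ (norm_ne_zero_iff.2 (sub_ne_zero.2 fun h' => h (Subtype.ext h')))

theorem dense_compl_pair {x y : S2} (hxy : x ≠ y) : Dense ({x, y}ᶜ : Set S2) := by
  have hr : 1 < Module.rank ℝ (EuclideanSpace ℝ (Fin 3)) := by
    rw [← Module.finrank_eq_rank, finrank_euclideanSpace_fin]
    norm_num
  have : ConnectedSpace S2 :=
    Subtype.connectedSpace (isConnected_sphere hr 0 zero_le_one)
  have : Nontrivial S2 := ⟨x, y, hxy⟩
  have h := (dense_univ (X := S2)).sdiff_finite (Set.toFinite {x, y})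
  rwa [← Set.compl_eq_univ_sdiff] at h

/-- Every linear functional on matrices is given by the trace pairing. -/
theorem exists_trace_mul {n : Type*} [Fintype n] [DecidableEq n] (Λ : Matrix n n ℂ →ₗ[ℂ] ℂ) :
    ∃ c : Matrix n n ℂ, ∀ b, Λ b = (b * c).trace := by
  refine ⟨Matrix.of fun j i => Λ (Matrix.single i j 1), fun b => ?_⟩
  conv_lhs => rw [Matrix.matrix_eq_sum_single b]
  simp only [map_sum, Matrix.trace, Matrix.diag, Matrix.mul_apply, Matrix.of_apply]
  refine Finset.sum_congr rfl fun i _ => Finset.sum_congr rfl fun j _ => ?_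
  rw [← mul_one (b i j), ← smul_eq_mul, ← Matrix.smul_single, map_smul]
  simp

/-- The kernel of quantization separates points. Otherwise `δ_x - δ_y` would be integration against
a symbol `σ(c)`; testing on `|z - x|² |z - y|² conj σ(c)` forces `σ(c) = 0`. -/
theorem exists_quantize_eq_zero_ne (N : ℕ) {x y : S2} (hxy : x ≠ y) :
    ∃ f : smoothAlg, quantize N f = 0 ∧ f.1 x ≠ f.1 y := by
  by_contra! H
  have hsurj : LinearMap.range (quantize N) = ⊤ := by
    rw [LinearMap.range_eq_top]
    exact Function.Surjective.of_comp (g := symbolAlg N) (quantize_symbolAlg_bijective N).2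
  obtain ⟨s, hs⟩ := (quantize N).exists_rightInverse_of_surjective hsurj
  obtain ⟨c, hc⟩ := exists_trace_mul ((pointEval x - pointEval y) ∘ₗ s)
  have hint (g : smoothAlg) :
      g.1 x - g.1 y = ((N : ℂ) + 1) * ∫ z, g.1 z * symbol N c z ∂sphereMeasure := by
    have h1 : quantize N (g - s (quantize N g)) = 0 := by
      rw [quantize_sub, sub_eq_zero]
      exact (LinearMap.congr_fun hs (quantize N g)).symm
    have h2 : g.1 x - (s (quantize N g)).1 x = g.1 y - (s (quantize N g)).1 y := H _ h1
    have h3 : (s (quantize N g)).1 x - (s (quantize N g)).1 y = (quantize N g * c).trace :=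
      hc (quantize N g)
    rw [← trace_quantize_mul, ← h3]
    linear_combination h2
  have hN : ((N : ℂ) + 1) ≠ 0 := by exact_mod_cast N.succ_ne_zero
  have hzero (z : S2) : symbol N c z = 0 := by
    have h1 := hint (star (symbolAlg N c) * (distSqAlg x * distSqAlg y))
    have e (z : S2) : (star (symbolAlg N c) * (distSqAlg x * distSqAlg y)).1 z =
        conj (symbol N c z) * ((distSqAlg x).1 z * (distSqAlg y).1 z) := rfl
    have e2 (z : S2) : conj (symbol N c z) * ((distSqAlg x).1 z * (distSqAlg y).1 z) *
        symbol N c z = ((‖symbol N c z‖ ^ 2 * (‖(z : EuclideanSpace ℝ (Fin 3)) - x‖ ^ 2 *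
          ‖(z : EuclideanSpace ℝ (Fin 3)) - y‖ ^ 2) : ℝ) : ℂ) := by
      rw [distSqAlg_apply, distSqAlg_apply, mul_right_comm, Complex.conj_mul']
      push_cast
      rfl
    simp only [e, e2] at h1
    rw [integral_complex_ofReal, distSqAlg_apply, distSqAlg_apply y y, sub_self, sub_self,
      norm_zero, zero_pow two_ne_zero, Complex.ofReal_zero, zero_mul, mul_zero, mul_zero, mul_zero,
      sub_self] at h1
    have h2 := Complex.ofReal_eq_zero.1 ((mul_eq_zero.1 h1.symm).resolve_left hN)
    have h3 := eq_zero_of_integral_eq_zero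
      (((continuous_symbol N c).norm.pow 2).mul
        (((continuous_subtype_val.sub continuous_const).norm.pow 2).mul
          ((continuous_subtype_val.sub continuous_const).norm.pow 2)))
      (fun z => mul_nonneg (sq_nonneg _) (mul_nonneg (sq_nonneg _) (sq_nonneg _))) h2
    refine congrFun (Continuous.ext_on (dense_compl_pair hxy) (continuous_symbol N c)
      continuous_const (g := fun _ => 0) fun z hz => ?_) z
    have hzx : z ≠ x := fun h => hz (Or.inl h)
    have hzy : z ≠ y := fun h => hz (Or.inr h)
    have h4 := (mul_eq_zero.1 (h3 z)).resolve_right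
      (mul_ne_zero (distSqAlg_ne_zero hzx) (distSqAlg_ne_zero hzy))
    exact norm_eq_zero.1 ((pow_eq_zero_iff two_ne_zero).1 h4)
  have h5 := hint (distSqAlg x)
  simp only [hzero, mul_zero, integral_zero] at h5
  rw [distSqAlg_apply, distSqAlg_apply, sub_self, norm_zero, zero_pow two_ne_zero,
    Complex.ofReal_zero, zero_sub, neg_eq_zero, Complex.ofReal_eq_zero] at h5
  exact distSqAlg_ne_zero hxy.symm h5

theorem exists_isSelfAdjoint_quantize_eq_zero_ne (N : ℕ) {x y : S2} (hxy : x ≠ y) :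
    ∃ f : smoothAlg, IsSelfAdjoint f ∧ quantize N f = 0 ∧ f.1 x ≠ f.1 y := by
  obtain ⟨f, hf, hne⟩ := exists_quantize_eq_zero_ne N hxy
  have hfs : quantize N (star f) = 0 := by rw [quantize_star, hf, Matrix.conjTranspose_zero]
  by_contra! H
  have h1 := H (f + star f) (IsSelfAdjoint.add_star_self f) (by rw [map_add, hf, hfs, add_zero])
  have h2 := H (Complex.I • (f - star f))
    (by
      ext z
      change conj (Complex.I * (f.1 z - conj (f.1 z))) = Complex.I * (f.1 z - conj (f.1 z))
      rw [map_mul, map_sub, Complex.conj_conj, Complex.conj_I]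
      ring)
    (by rw [map_smul, quantize_sub, hf, hfs, sub_zero, smul_zero])
  have h1' : f.1 x + conj (f.1 x) = f.1 y + conj (f.1 y) := h1
  have h2' : Complex.I * (f.1 x - conj (f.1 x)) = Complex.I * (f.1 y - conj (f.1 y)) := h2
  have h3 := mul_left_cancel₀ Complex.I_ne_zero h2'
  exact hne (by linear_combination (h1' + h3) / 2)

theorem diracSeminorm_berezin_of_quantize_eq_zero {N : ℕ} {f : smoothAlg}
    (hf : quantize N f = 0) : diracSeminorm (berezin N f) ≤ 1 := by
  rw [berezin, hf]
  refine diracSeminorm_symbol_le_one ((fuzzySeminorm_le_one_iff N 0).2 fun v => ?_)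
  have h : amplify N 0 = 0 := Matrix.fromBlocks_zero
  rw [h, Matrix.mul_zero, Matrix.zero_mul, sub_zero, Matrix.zero_mulVec]
  simp only [Pi.zero_apply, norm_zero, zero_pow two_ne_zero, Finset.sum_const_zero]
  positivity

theorem berezinDist_pointEval_eq_top (N : ℕ) {x y : S2} (hxy : x ≠ y) :
    berezinDist N (pointEval x) (pointEval y) = ⊤ := by
  obtain ⟨f, hsa, hf, hne⟩ := exists_isSelfAdjoint_quantize_eq_zero_ne N hxy
  have hreal (z : S2) : (((f.1 z).re : ℝ) : ℂ) = f.1 z :=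
    Complex.conj_eq_iff_re.1 (congrArg (fun g : smoothAlg => g.1 z) hsa.star_eq)
  have hre : (f.1 x).re - (f.1 y).re ≠ 0 := fun h => hne (by
    rw [← hreal x, ← hreal y, sub_eq_zero.1 h])
  rw [EReal.eq_top_iff_forall_lt]
  intro r
  set t : ℝ := (r + 1) / ((f.1 x).re - (f.1 y).re) with ht
  have hq : quantize N ((t : ℂ) • f) = 0 := by rw [map_smul, hf, smul_zero]
  have hsa' : IsSelfAdjoint ((t : ℂ) • f) := by
    rw [IsSelfAdjoint, star_smul, hsa.star_eq, Complex.star_def, Complex.conj_ofReal]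
  refine lt_of_lt_of_le ?_ (le_iSup₂_of_le (f := fun (f : smoothAlg)
    (_ : IsSelfAdjoint f ∧ diracSeminorm (berezin N f) ≤ 1) =>
    (((pointEval x f - pointEval y f).re : ℝ) : EReal)) ((t : ℂ) • f)
    ⟨hsa', diracSeminorm_berezin_of_quantize_eq_zero hq⟩ le_rfl)
  have hval : (pointEval x ((t : ℂ) • f) - pointEval y ((t : ℂ) • f)).re = r + 1 := by
    change ((t : ℂ) * f.1 x - (t : ℂ) * f.1 y).re = r + 1
    rw [← mul_sub, Complex.re_ofReal_mul, Complex.sub_re, ht, div_mul_cancel₀ _ hre]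
  rw [hval]
  exact EReal.coe_lt_coe_iff.2 (lt_add_one r)

/-! ### Finiteness of the Berezin distance between pulled back states -/

/-- On a finite dimensional space, a functional that vanishes on the kernel of `T` is bounded by
the norm of `T`: it factors through the range of `T`, where every functional is continuous. -/
theorem exists_norm_le_of_ker_le {E F : Type*} [AddCommGroup E] [Module ℂ E]
    [FiniteDimensional ℂ E] [NormedAddCommGroup F] [NormedSpace ℂ F] (T : E →ₗ[ℂ] F)
    (Λ : E →ₗ[ℂ] ℂ) (h : LinearMap.ker T ≤ LinearMap.ker Λ) :
    ∃ C : ℝ, 0 ≤ C ∧ ∀ a, ‖Λ a‖ ≤ C * ‖T a‖ := by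
  let g : LinearMap.range T →ₗ[ℂ] ℂ :=
    (LinearMap.ker T).liftQ Λ h ∘ₗ T.quotKerEquivRange.symm.toLinearMap
  refine ⟨‖LinearMap.toContinuousLinearMap g‖,
    norm_nonneg (LinearMap.toContinuousLinearMap g), fun a => ?_⟩
  have hg : LinearMap.toContinuousLinearMap g ⟨T a, LinearMap.mem_range_self T a⟩ = Λ a := by
    have h1 : T.quotKerEquivRange.symm ⟨T a, LinearMap.mem_range_self T a⟩ =
        (LinearMap.ker T).mkQ a :=
      T.quotKerEquivRange_symm_apply_image a (LinearMap.mem_range_self T a)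
    change (LinearMap.ker T).liftQ Λ h
      (T.quotKerEquivRange.symm ⟨T a, LinearMap.mem_range_self T a⟩) = Λ a
    rw [h1]
    exact (LinearMap.ker T).liftQ_apply Λ a
  rw [← hg]
  exact (LinearMap.toContinuousLinearMap g).le_opNorm _

/-- The derivatives of the symbol of `a` along the three rotations. -/
def symbolGrad (N : ℕ) : FuzzyAlg N →ₗ[ℂ] (Fin 3 → C(S2, ℂ)) where
  toFun a j := (symbolAlg N (comm (spinGen N j) a)).1
  map_add' a b := by
    funext j
    rw [comm, Matrix.mul_add, Matrix.add_mul, add_sub_add_comm, map_add]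
    rfl
  map_smul' c a := by
    funext j
    rw [comm, Matrix.mul_smul, Matrix.smul_mul, ← smul_sub, map_smul]
    rfl

theorem symbolGrad_apply (N : ℕ) (a : FuzzyAlg N) (j : Fin 3) (x : S2) :
    symbolGrad N a j x = angMom j (symbol N a) x :=
  (angMom_symbol N j a x).symm

theorem norm_symbolGrad_le_one {N : ℕ} {a : FuzzyAlg N} (h : diracSeminorm (symbol N a) ≤ 1) :
    ‖symbolGrad N a‖ ≤ 1 := by
  have h' : ∀ x u, normSq2 (gradMul (symbol N a) x u) ≤ normSq2 u :=
    (diracSeminorm_le_one_iff (symbolAlg N a)).1 h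
  have hsq {z : ℂ} (hz : ‖z‖ ^ 2 ≤ 1) : ‖z‖ ≤ 1 :=
    (sq_le_one_iff₀ (norm_nonneg z)).1 hz
  have h0 (x : S2) : ‖partialH (symbol N a) x‖ ^ 2 + ‖partialE (symbol N a) x‖ ^ 2 ≤ 1 := by
    have := h' x ![1, 0]
    simpa [normSq2, gradMul] using this
  have h1 (x : S2) : ‖partialF (symbol N a) x‖ ^ 2 + ‖partialH (symbol N a) x‖ ^ 2 ≤ 1 := by
    have := h' x ![0, 1]
    simpa [normSq2, gradMul] using this
  have hH (x : S2) : ‖partialH (symbol N a) x‖ ≤ 1 :=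
    hsq (by nlinarith [h0 x, sq_nonneg ‖partialE (symbol N a) x‖])
  have hE (x : S2) : ‖partialE (symbol N a) x‖ ≤ 1 :=
    hsq (by nlinarith [h0 x, sq_nonneg ‖partialH (symbol N a) x‖])
  have hF (x : S2) : ‖partialF (symbol N a) x‖ ≤ 1 :=
    hsq (by nlinarith [h1 x, sq_nonneg ‖partialH (symbol N a) x‖])
  refine (pi_norm_le_iff_of_nonneg zero_le_one).2 fun j =>
    (ContinuousMap.norm_le _ zero_le_one).2 fun x => ?_
  rw [symbolGrad_apply]
  match j with
  | 0 =>
    have e : angMom 0 (symbol N a) x =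
        (partialE (symbol N a) x + partialF (symbol N a) x) / 2 := by
      rw [partialE, partialF]
      ring
    rw [e, norm_div, Complex.norm_ofNat, div_le_one two_pos]
    linarith [norm_add_le (partialE (symbol N a) x) (partialF (symbol N a) x), hE x, hF x]
  | 1 =>
    have e : Complex.I * angMom 1 (symbol N a) x =
        (partialE (symbol N a) x - partialF (symbol N a) x) / 2 := by
      rw [partialE, partialF]
      ring
    have e' : ‖angMom 1 (symbol N a) x‖ = ‖Complex.I * angMom 1 (symbol N a) x‖ := by
      rw [norm_mul, Complex.norm_I, one_mul]
    rw [e', e, norm_div, Complex.norm_ofNat, div_le_one two_pos]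
    linarith [norm_sub_le (partialE (symbol N a) x) (partialF (symbol N a) x), hE x, hF x]
  | 2 => exact hH x

theorem berezinDist_sharp_lt_top (N : ℕ) {φ ψ : FuzzyAlg N →ₗ[ℂ] ℂ} (hφ : φ 1 = 1)
    (hψ : ψ 1 = 1) : berezinDist N (sharp N φ) (sharp N ψ) < ⊤ := by
  obtain ⟨C, hC0, hC⟩ := exists_norm_le_of_ker_le (symbolGrad N) (φ - ψ) fun a ha => by
    obtain ⟨c, rfl⟩ := exists_eq_smul_one_of_commute (a := a) fun j => by
      refine sub_eq_zero.1 (symbol_injective fun x => ?_)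
      exact congrArg (fun g : Fin 3 → C(S2, ℂ) => g j x) (LinearMap.mem_ker.1 ha)
    rw [LinearMap.mem_ker, map_smul, LinearMap.sub_apply, hφ, hψ, sub_self, smul_zero]
  refine lt_of_le_of_lt (b := (C : EReal)) (iSup₂_le fun f hf => EReal.coe_le_coe_iff.2 ?_)
    (EReal.coe_lt_top C)
  calc (sharp N φ f - sharp N ψ f).re ≤ ‖(φ - ψ) (quantize N f)‖ := Complex.re_le_norm _
    _ ≤ C * ‖symbolGrad N (quantize N f)‖ := hC _
    _ ≤ C := mul_le_of_le_one_right hC0 (norm_symbolGrad_le_one hf.2)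

end FuzzySphere

end

theorem mainTheorem12 (N : ℕ) :
    (∀ φ ψ : FuzzySphere.FuzzyAlg N →ₗ[ℂ] ℂ,
      FuzzySphere.IsState φ → FuzzySphere.IsState ψ →
        FuzzySphere.flatDist N φ ψ ≤ FuzzySphere.fuzzyDist N φ ψ ∧
        FuzzySphere.fuzzyDist N φ ψ ≤
          FuzzySphere.berezinDist N (FuzzySphere.sharp N φ) (FuzzySphere.sharp N ψ)) ∧
    (∀ x y : FuzzySphere.S2, x ≠ y →
      FuzzySphere.berezinDist N (FuzzySphere.pointEval x) (FuzzySphere.pointEval y) = ⊤) ∧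
    (∀ φ ψ : FuzzySphere.FuzzyAlg N →ₗ[ℂ] ℂ,
      FuzzySphere.IsState φ → FuzzySphere.IsState ψ →
        FuzzySphere.berezinDist N (FuzzySphere.sharp N φ) (FuzzySphere.sharp N ψ) < ⊤) :=
  ⟨fun φ ψ _ _ => ⟨FuzzySphere.flatDist_le_fuzzyDist N φ ψ,
      FuzzySphere.fuzzyDist_le_berezinDist N φ ψ⟩,
    fun _ _ hxy => FuzzySphere.berezinDist_pointEval_eq_top N hxy,
    fun _ _ hφ hψ => FuzzySphere.berezinDist_sharp_lt_top N hφ.2 hψ.2⟩
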